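/- Let $d\ge 0$ and let $\mathbb{T}^d=\mathbb{R}^d/\mathbb{Z}^d$ be the $d$-dimensional torus, with the metric induced by the maximum norm on $\mathbb{R}^d$ and with its Haar probability measure $m$. Call an endomorphism of $\mathbb{T}^d$, given by a $d\times d$ integer matrix $M$, hyperbolic if $M$ is nonsingular and has no complex eigenvalue of modulus $1$. The subspace of $\mathbb{R}^d$ contracted by $M$ is the set of real vectors lying in the sum, in $\mathbb{C}^d$, of the generalized eigenspaces of $M$ for the eigenvalues of modulus less than $1$. For such an endomorphism put $$Eq(M)=\Bigl\{x\in\mathbb{T}^d : \lim_{N\to\infty}\frac1N\sum_{n=0}^{N-1} f(M^n x)=\int_{\mathbb{T}^d} f\,dm\ \text{ for all } f\in C(\mathbb{T}^d)\Bigr\},$$ $$ND(M)=\Bigl\{x\in\mathbb{T}^d : \overline{\{M^n x : n\ge 0\}}\ne\mathbb{T}^d\Bigr\}.$$ **Theorem.** Let $S$ and $T$ be hyperbolic endomorphisms of $\mathbb{T}^d$, and let $\mathfrak{s}_-$ and $\mathfrak{t}_-$ be the subspaces of $\mathbb{R}^d$ contracted by $S$ and by $T$ respectively. Assume that $\mathfrak{s}_-$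 and $\mathfrak{t}_-$ are both nonzero and that $\mathfrak{s}_-+\mathfrak{t}_-=\mathbb{R}^d$. Then $$\dim\bigl(Eq(S)\cap ND(T)\bigr)=d,$$ where $\dim$ denotes Hausdorff dimension. -/

import Mathlib

open MeasureTheory Filter Topology

noncomputable section

namespace ToralEndo

/-- The `d`-dimensional torus `ℝ^d / ℤ^d`, realised as the `d`-fold product of the circle `ℝ / ℤ`,
with the quotient of the maximum metric. Its `volume` is the Haar probability measure. -/
abbrev Torus (d : ℕ) : Type := UnitAddTorus (Fin d)

/-- The endomorphism of the torus given by an integer matrix. -/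
def toralMap {d : ℕ} (M : Matrix (Fin d) (Fin d) ℤ) (x : Torus d) : Torus d :=
  fun i => ∑ j, M i j • x j

/-- The canonical projection from `ℝ^d` to the torus. -/
def proj {d : ℕ} (v : Fin d → ℝ) : Torus d := fun i => (v i : UnitAddCircle)

/-- The toral map is the one induced by the linear action of the matrix on `ℝ^d`. -/
theorem toralMap_proj {d : ℕ} (M : Matrix (Fin d) (Fin d) ℤ) (v : Fin d → ℝ) :
    toralMap M (proj v) = proj ((M.map (Int.cast : ℤ → ℝ)).mulVec v) := by
  funext i
  have h : ∀ w : Fin d → ℝ,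
      ((∑ j, w j : ℝ) : UnitAddCircle) = ∑ j, (w j : UnitAddCircle) := fun w =>
    map_sum (QuotientAddGroup.mk' (AddSubgroup.zmultiples (1 : ℝ))) w Finset.univ
  simp only [toralMap, proj, Matrix.mulVec, dotProduct, Matrix.map_apply, h]
  refine Finset.sum_congr rfl fun j _ => ?_
  rw [← zsmul_eq_mul]
  rfl

/-- The matrix as a linear endomorphism of `ℂ^d`. -/
def complexEnd {d : ℕ} (M : Matrix (Fin d) (Fin d) ℤ) : Module.End ℂ (Fin d → ℂ) :=
  Matrix.toLin' (M.map (Int.cast : ℤ → ℂ))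

/-- A hyperbolic toral endomorphism: nonsingular, with no complex eigenvalue of modulus `1`. -/
structure IsHyperbolic {d : ℕ} (M : Matrix (Fin d) (Fin d) ℤ) : Prop where
  nonsingular : M.det ≠ 0
  norm_ne_one : ∀ μ : ℂ, (complexEnd M).HasEigenvalue μ → ‖μ‖ ≠ 1

/-- The inclusion of `ℝ^d` in `ℂ^d`, as a real linear map. -/
def complexify (d : ℕ) : (Fin d → ℝ) →ₗ[ℝ] (Fin d → ℂ) where
  toFun v := fun i => (v i : ℂ)
  map_add' v w := by funext i; simp
  map_smul' c v := by funext i; simp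

/-- The contracted subspace: the real vectors lying in the sum of the generalized eigenspaces
for the complex eigenvalues of modulus less than `1`. -/
def contracted {d : ℕ} (M : Matrix (Fin d) (Fin d) ℤ) : Submodule ℝ (Fin d → ℝ) :=
  ((⨆ μ : ℂ, ⨆ _ : ‖μ‖ < 1, (complexEnd M).maxGenEigenspace μ).restrictScalars ℝ).comap
    (complexify d)

/-- The points whose forward orbit equidistributes with respect to Haar measure. -/
def Equi {d : ℕ} (M : Matrix (Fin d) (Fin d) ℤ) : Set (Torus d) :=
  {x | ∀ f : C(Torus d, ℂ),
    Tendsto (fun N : ℕ => (N : ℂ)⁻¹ * ∑ n ∈ Finset.range N, f ((toralMap M)^[n] x))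
      atTop (𝓝 (∫ y, f y))}

/-- The points with dense forward orbit. -/
def D {d : ℕ} (M : Matrix (Fin d) (Fin d) ℤ) : Set (Torus d) :=
  {x | closure (Set.range fun n : ℕ => (toralMap M)^[n] x) = Set.univ}

/-- The points with nondense forward orbit. -/
def ND {d : ℕ} (M : Matrix (Fin d) (Fin d) ℤ) : Set (Torus d) := (D M)ᶜ

end ToralEndo

end

/-!
The set `Equi S` is invariant under translation by the subspace contracted by `S`, and `ND T` under
translation by the subspace contracted by `T`, because such translations do not change the
asymptotic behaviour of orbits. Choose a complement `V` of `contracted T` inside `contracted S`. In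
the linear coordinates `V × contracted T` of `ℝ ^ d`, whether a point projects into `Equi S` is
decided by the second coordinate alone, and whether it projects into `ND T` by the first alone. So
the intersection contains a bi-Lipschitz copy of a product `X × Y`
(`add_le_dimH_equi_inter_nd`).

* `Y` has positive Lebesgue measure: almost every orbit of `S` equidistributes (`ae_mem_equi`), and
  Fubini's theorem passes this on to the slices. For a nontrivial character `χ` the functions
  `χ ∘ S ^ n` are pairwise orthogonal, since no eigenvalue of `S` is a root of unity. The second
  moment bound then gives almost everywhere convergence of the averages along the squares, hence
  along all times, and Weyl's criterion applies. No general ergodic theorem is used.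

* `X` consists of vectors `v` of `V` for which `T ^ n v` stays `δ`-away from the integer points for
  all `n`. It carries, for every `s < dim V`, a probability measure giving mass at most
  `D * diam E ^ s` to every set `E` (`exists_measure_avoiding`). As `V` meets `contracted T`
  trivially, `T ^ n` expands `V` exponentially (`exists_norm_mulVec_le_of_disjoint`), although not
  conformally. A grid cube of side comparable to `1 / ‖T ^ n‖` is mapped to a set so small that it
  sees only one integer point, and the points mapped near it lie in a thin slab transverse to the
  direction of strongest expansion. Of the `N ^ k` subcubes of the cube the slab removes only
  `O(N ^ (k - 1))`, and only `O(log N)` times `n` compete at each scale. For large `N` more than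
  `N ^ s` subcubes are left, and a random nested sequence of them has the required law
  (`exists_measure_isAddress`).

The product of this measure with Lebesgue measure on `Y` satisfies the hypothesis of the mass
distribution principle with exponent `s + dim (contracted T)`, and `s` is arbitrarily close to
`dim V`.
-/

open MeasureTheory Filter Topology

noncomputable section

namespace ToralEndo

/-! ### Spectral splitting of a hyperbolic linear map -/

section Spectral

variable {F : Type*} [NormedAddCommGroup F] [NormedSpace ℂ F]

/-- Gelfand's formula: an endomorphism with all eigenvalues inside the unit disc contracts
exponentially. -/
theorem exists_norm_pow_apply_le [FiniteDimensional ℂ F] (f : Module.End ℂ F)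
    (h : ∀ μ, f.HasEigenvalue μ → ‖μ‖ < 1) :
    ∃ C > 0, ∃ θ : ℝ, 0 < θ ∧ θ < 1 ∧ ∀ n v, ‖(f ^ n) v‖ ≤ C * θ ^ n * ‖v‖ := by
  rcases subsingleton_or_nontrivial F with hF | hF
  · refine ⟨1, one_pos, 1 / 2, by norm_num, by norm_num, fun n v => ?_⟩
    rw [Subsingleton.elim ((f ^ n) v) 0, norm_zero]
    positivity
  have : CompleteSpace F := FiniteDimensional.complete ℂ F
  set a := Module.End.toContinuousLinearMap F f with ha
  have hr : spectralRadius ℂ a < ((1 : NNReal) : ENNReal) := by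
    refine spectrum.spectralRadius_lt_of_forall_lt a fun z hz => ?_
    rw [ha, AlgEquiv.spectrum_eq] at hz
    exact_mod_cast h z (Module.End.HasEigenvalue.of_mem_spectrum hz)
  obtain ⟨r, hr1, hr2⟩ := ENNReal.lt_iff_exists_nnreal_btwn.1 hr
  have hr2' : (r : ℝ) < 1 := by exact_mod_cast ENNReal.coe_lt_coe.1 hr2
  have hr0 : 0 < (r : ℝ) := by
    have : (0 : ENNReal) < r := lt_of_le_of_lt bot_le hr1
    exact_mod_cast this
  have hev : ∀ᶠ n : ℕ in atTop, ‖a ^ n‖ ≤ 1 * ‖(r : ℝ) ^ n‖ := by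
    filter_upwards [(spectrum.pow_nnnorm_pow_one_div_tendsto_nhds_spectralRadius a).eventually
      (gt_mem_nhds hr1), eventually_gt_atTop 0] with n hn hn0
    have hn0' : (0 : ℝ) < n := by exact_mod_cast hn0
    have h1 := ENNReal.rpow_le_rpow hn.le hn0'.le
    rw [← ENNReal.rpow_mul, one_div, inv_mul_cancel₀ hn0'.ne', ENNReal.rpow_one,
      ENNReal.rpow_natCast] at h1
    have h2 : ‖a ^ n‖₊ ≤ r ^ n := by exact_mod_cast h1
    have h3 : ‖a ^ n‖ ≤ (r : ℝ) ^ n := by exact_mod_cast h2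
    rw [one_mul, Real.norm_of_nonneg (by positivity)]
    exact h3
  obtain ⟨C, hC, hCb⟩ := Asymptotics.bound_of_isBigO_nat_atTop (Asymptotics.IsBigO.of_bound 1 hev)
  refine ⟨C, hC, r, hr0, hr2', fun n v => ?_⟩
  have h4 : (a ^ n) v = (f ^ n) v := by
    rw [ha, ← map_pow]; rfl
  rw [← h4]
  refine ((a ^ n).le_opNorm v).trans ?_
  have := hCb (x := n) (pow_pos hr0 n).ne'
  rw [Real.norm_of_nonneg (by positivity)] at this
  gcongr

/-- The sum of the generalized eigenspaces for the eigenvalues in a set `s`. -/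
def spectralSubspace (f : Module.End ℂ F) (s : Set ℂ) : Submodule ℂ F :=
  ⨆ μ ∈ s, f.maxGenEigenspace μ

theorem mapsTo_spectralSubspace (f : Module.End ℂ F) (s : Set ℂ) :
    ∀ v ∈ spectralSubspace f s, f v ∈ spectralSubspace f s := by
  intro v hv
  have : spectralSubspace f s ≤ (spectralSubspace f s).comap f := by
    refine iSup₂_le fun μ hμ w hw => ?_
    exact le_iSup₂ (f := fun μ (_ : μ ∈ s) => f.maxGenEigenspace μ) μ hμ
      (Module.End.mapsTo_maxGenEigenspace_of_comm (Commute.refl f) μ hw)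
  exact this hv

theorem disjoint_spectralSubspace (f : Module.End ℂ F) {s t : Set ℂ} (h : Disjoint s t) :
    Disjoint (spectralSubspace f s) (spectralSubspace f t) :=
  (Module.End.independent_maxGenEigenspace f).disjoint_biSup_biSup h

/-- An eigenvalue of the restriction to a spectral subspace lies in the defining set. -/
theorem mem_of_hasEigenvalue_restrict (f : Module.End ℂ F) (s : Set ℂ) {μ : ℂ}
    (h : Module.End.HasEigenvalue (f.restrict (mapsTo_spectralSubspace f s)) μ) : μ ∈ s := by
  by_contra hμ
  obtain ⟨v, hv⟩ := h.exists_hasEigenvector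
  have h1 : f (v : F) = μ • (v : F) := congrArg Subtype.val hv.apply_eq_smul
  have h2 : (v : F) ∈ spectralSubspace f {μ} := by
    refine le_iSup₂ (f := fun ν (_ : ν ∈ ({μ} : Set ℂ)) => f.maxGenEigenspace ν) μ rfl ?_
    exact Module.End.eigenspace_le_maxGenEigenspace (Module.End.mem_eigenspace_iff.2 h1)
  have h3 : (v : F) = 0 :=
    Submodule.disjoint_def.1 (disjoint_spectralSubspace f (Set.disjoint_singleton_right.2 hμ))
      v v.2 h2
  exact hv.2 (Subtype.ext h3)

theorem coe_restrict_pow (f : Module.End ℂ F) {p : Submodule ℂ F} (hp : ∀ v ∈ p, f v ∈ p) (n : ℕ)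
    (v : p) : (((f.restrict hp) ^ n) v : F) = (f ^ n) v := by
  rw [Module.End.pow_restrict]; rfl

theorem exists_norm_pow_le_of_mem_spectralSubspace [FiniteDimensional ℂ F]
    (f : Module.End ℂ F) :
    ∃ C > 0, ∃ θ : ℝ, 0 < θ ∧ θ < 1 ∧ ∀ n, ∀ v ∈ spectralSubspace f {μ | ‖μ‖ < 1},
      ‖(f ^ n) v‖ ≤ C * θ ^ n * ‖v‖ := by
  obtain ⟨C, hC, θ, h0, h1, h⟩ := exists_norm_pow_apply_le
    (f.restrict (mapsTo_spectralSubspace f {μ | ‖μ‖ < 1}))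
    fun μ hμ => mem_of_hasEigenvalue_restrict f _ hμ
  refine ⟨C, hC, θ, h0, h1, fun n v hv => ?_⟩
  have := h n ⟨v, hv⟩
  rw [← coe_restrict_pow f (mapsTo_spectralSubspace f _) n ⟨v, hv⟩]
  exact this

/-- On the expanded subspace, the inverse is a contraction with eigenvalues in the unit disc. -/
theorem exists_norm_le_norm_pow_of_mem_spectralSubspace [FiniteDimensional ℂ F]
    (f : Module.End ℂ F) :
    ∃ C > 0, ∃ θ : ℝ, 0 < θ ∧ θ < 1 ∧ ∀ n, ∀ v ∈ spectralSubspace f {μ | 1 < ‖μ‖},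
      ‖v‖ ≤ C * θ ^ n * ‖(f ^ n) v‖ := by
  set g := f.restrict (mapsTo_spectralSubspace f {μ | 1 < ‖μ‖}) with hg
  have hinj : Function.Injective g := by
    rw [← LinearMap.ker_eq_bot]
    by_contra hker
    have h0 : Module.End.HasEigenvalue g 0 := by
      rwa [Module.End.hasEigenvalue_iff, Module.End.eigenspace_zero]
    have := mem_of_hasEigenvalue_restrict f _ h0
    simp at this
    linarith
  set e := LinearEquiv.ofInjectiveEndo g hinj with he
  have hge : ∀ v, e v = g v := fun v => rfl
  obtain ⟨C, hC, θ, h0, h1, h⟩ := exists_norm_pow_apply_le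
    (e.symm : Module.End ℂ (spectralSubspace f {μ | 1 < ‖μ‖})) (by
      intro μ hμ
      obtain ⟨v, hv⟩ := hμ.exists_hasEigenvector
      have h1 : e.symm v = μ • v := hv.apply_eq_smul
      have h2 : v = μ • g v := by
        rw [← hge, ← map_smul, ← h1, LinearEquiv.apply_symm_apply]
      have hμ0 : μ ≠ 0 := by
        rintro rfl
        rw [zero_smul] at h2
        exact hv.2 h2
      have h3 : g v = μ⁻¹ • v := by
        conv_rhs => rw [h2]
        rw [smul_smul, inv_mul_cancel₀ hμ0, one_smul]
      have h4 : Module.End.HasEigenvalue g μ⁻¹ :=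
        Module.End.hasEigenvalue_of_hasEigenvector
          ⟨Module.End.mem_eigenspace_iff.2 h3, hv.2⟩
      have h5 : 1 < ‖μ⁻¹‖ := mem_of_hasEigenvalue_restrict f _ h4
      rw [norm_inv] at h5
      exact (one_lt_inv₀ (norm_pos_iff.2 hμ0)).1 h5)
  refine ⟨C, hC, θ, h0, h1, fun n v hv => ?_⟩
  have h2 : ∀ (n : ℕ) w, ((e.symm : Module.End ℂ (spectralSubspace f {μ | 1 < ‖μ‖})) ^ n)
      ((g ^ n) w) = w := by
    intro n
    induction n with
    | zero => intro w; rfl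
    | succ n ih =>
      intro w
      rw [pow_succ, pow_succ', Module.End.mul_apply, Module.End.mul_apply, ← hge]
      simpa using ih w
  have h3 := h n ((g ^ n) ⟨v, hv⟩)
  rw [h2] at h3
  rw [← coe_restrict_pow f (mapsTo_spectralSubspace f _) n ⟨v, hv⟩]
  exact h3

theorem isCompl_spectralSubspace [FiniteDimensional ℂ F] (f : Module.End ℂ F)
    (h : ∀ μ, f.HasEigenvalue μ → ‖μ‖ ≠ 1) :
    IsCompl (spectralSubspace f {μ | ‖μ‖ < 1}) (spectralSubspace f {μ | 1 < ‖μ‖}) := by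
  refine ⟨disjoint_spectralSubspace f ?_, codisjoint_iff.2 ?_⟩
  · rw [Set.disjoint_left]
    intro μ h1 h2
    exact lt_asymm (Set.mem_ofPred.1 h1) (Set.mem_ofPred.1 h2)
  · rw [eq_top_iff, ← Module.End.iSup_maxGenEigenspace_eq_top f]
    refine iSup_le fun μ => ?_
    rcases lt_trichotomy ‖μ‖ 1 with h1 | h1 | h1
    · exact le_sup_of_le_left
        (le_iSup₂ (f := fun μ (_ : μ ∈ {μ : ℂ | ‖μ‖ < 1}) => f.maxGenEigenspace μ) μ h1)
    · have : f.maxGenEigenspace μ = ⊥ := by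
        by_contra h2
        exact h μ (Module.End.HasUnifEigenvalue.lt (k := ⊤) zero_lt_one h2) h1
      rw [this]; exact bot_le
    · exact le_sup_of_le_right
        (le_iSup₂ (f := fun μ (_ : μ ∈ {μ : ℂ | 1 < ‖μ‖}) => f.maxGenEigenspace μ) μ h1)

end Spectral

/-- The real matrix of an integer matrix. -/
def realMat {d : ℕ} (M : Matrix (Fin d) (Fin d) ℤ) : Matrix (Fin d) (Fin d) ℝ :=
  M.map (Int.cast : ℤ → ℝ)

theorem mem_contracted_iff {d : ℕ} (M : Matrix (Fin d) (Fin d) ℤ) (v : Fin d → ℝ) :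
    v ∈ contracted M ↔ complexify d v ∈ spectralSubspace (complexEnd M) {μ | ‖μ‖ < 1} := Iff.rfl

theorem complexEnd_complexify {d : ℕ} (M : Matrix (Fin d) (Fin d) ℤ) (v : Fin d → ℝ) :
    complexEnd M (complexify d v) = complexify d ((realMat M).mulVec v) := by
  funext i
  simp [complexEnd, complexify, realMat, Matrix.mulVec, dotProduct]

theorem complexEnd_pow_complexify {d : ℕ} (M : Matrix (Fin d) (Fin d) ℤ) (n : ℕ)
    (v : Fin d → ℝ) :
    (complexEnd M ^ n) (complexify d v) = complexify d ((realMat M ^ n).mulVec v) := by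
  induction n generalizing v with
  | zero => simp
  | succ n ih =>
    rw [pow_succ, pow_succ, Module.End.mul_apply, complexEnd_complexify, ih, Matrix.mulVec_mulVec]

theorem norm_complexify {d : ℕ} (v : Fin d → ℝ) : ‖complexify d v‖ = ‖v‖ := by
  simp [complexify, Pi.norm_def]

theorem tendsto_mulVec_of_mem_contracted {d : ℕ} {M : Matrix (Fin d) (Fin d) ℤ} {v : Fin d → ℝ}
    (hv : v ∈ contracted M) :
    Tendsto (fun n : ℕ => (realMat M ^ n).mulVec v) atTop (𝓝 0) := by
  obtain ⟨C, hC, θ, h0, h1, h⟩ := exists_norm_pow_le_of_mem_spectralSubspace (complexEnd M)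
  have h2 : Tendsto (fun n : ℕ => C * θ ^ n * ‖v‖) atTop (𝓝 0) := by
    simpa using ((tendsto_pow_atTop_nhds_zero_of_lt_one h0.le h1).const_mul C).mul_const ‖v‖
  refine squeeze_zero_norm (fun n => ?_) h2
  have := h n _ ((mem_contracted_iff M v).1 hv)
  rwa [complexEnd_pow_complexify, norm_complexify, norm_complexify] at this

/-- On a subspace that meets the contracted subspace trivially, forward orbits grow
exponentially, uniformly from every time on. -/
theorem exists_norm_mulVec_le_of_disjoint {d : ℕ} {M : Matrix (Fin d) (Fin d) ℤ}
    (hM : IsHyperbolic M) {V : Submodule ℝ (Fin d → ℝ)} (hV : Disjoint V (contracted M)) :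
    ∃ C > 0, ∃ θ : ℝ, 0 < θ ∧ θ < 1 ∧ ∀ n m : ℕ, ∀ v ∈ V,
      ‖(realMat M ^ n).mulVec v‖ ≤ C * θ ^ m * ‖(realMat M ^ (n + m)).mulVec v‖ := by
  set f := complexEnd M with hf
  set P := spectralSubspace f {μ | ‖μ‖ < 1} with hP
  set Q := spectralSubspace f {μ | 1 < ‖μ‖} with hQ
  have hc : IsCompl P Q := isCompl_spectralSubspace f hM.norm_ne_one
  obtain ⟨C₁, hC₁, θ₁, h0₁, h1₁, hb₁⟩ := exists_norm_pow_le_of_mem_spectralSubspace f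
  obtain ⟨C₂, hC₂, θ, h0, h1, hb₂⟩ := exists_norm_le_norm_pow_of_mem_spectralSubspace f
  set p : (Fin d → ℂ) →L[ℂ] P := LinearMap.toContinuousLinearMap (P.projectionOnto Q hc) with hp
  set q : (Fin d → ℂ) →L[ℂ] Q := LinearMap.toContinuousLinearMap (Q.projectionOnto P hc.symm)
    with hq
  have hpq : ∀ v, (p v : Fin d → ℂ) + q v = v := fun v =>
    Submodule.projection_add_projection_eq_self hc v
  have hqQ : ∀ v ∈ Q, (q v : Fin d → ℂ) = v := fun v hv => by
    simpa [hq] using congrArg Subtype.val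
      (Submodule.projectionOnto_apply_left hc.symm ⟨v, hv⟩)
  have hqP : ∀ v ∈ P, q v = 0 := fun v hv => by
    simpa [hq] using hv
  -- the projection to the expanded subspace is injective on `V`
  set j : V →ₗ[ℝ] Q := (q.toLinearMap.restrictScalars ℝ) ∘ₗ (complexify d) ∘ₗ V.subtype with hj
  have hker : LinearMap.ker j = ⊥ := by
    rw [LinearMap.ker_eq_bot']
    intro v hv
    have h2 : q (complexify d v) = 0 := hv
    have h3 : complexify d v ∈ P := by
      have := hpq (complexify d v)
      rw [h2, Submodule.coe_zero, add_zero] at this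
      rw [← this]; exact (p _).2
    exact Subtype.ext (hV.le_bot ⟨v.2, (mem_contracted_iff M _).2 h3⟩)
  obtain ⟨K, hK, hKj⟩ := j.exists_antilipschitzWith hker
  have hcomm : ∀ n v, (q ((f ^ n) v) : Fin d → ℂ) = (f ^ n) (q v) := by
    intro n v
    have hPn : ∀ w : P, (f ^ n) (w : Fin d → ℂ) ∈ P := fun w => by
      rw [← coe_restrict_pow f (mapsTo_spectralSubspace f _) n w]; exact Subtype.prop _
    have hQn : ∀ w : Q, (f ^ n) (w : Fin d → ℂ) ∈ Q := fun w => by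
      rw [← coe_restrict_pow f (mapsTo_spectralSubspace f _) n w]; exact Subtype.prop _
    conv_lhs => rw [← hpq v, map_add, map_add, hqP _ (hPn _), zero_add]
    exact hqQ _ (hQn _)
  refine ⟨(C₁ * (‖p‖ * K) * C₂ + 1) * (C₂ * (‖q‖ + 1)), by positivity, θ, h0, h1,
    fun n m v hv => ?_⟩
  set w := complexify d v with hw
  have e1 : ‖(realMat M ^ n).mulVec v‖ = ‖(f ^ n) w‖ := by
    rw [hf, hw, complexEnd_pow_complexify, norm_complexify]
  have e2 : ‖(realMat M ^ (n + m)).mulVec v‖ = ‖(f ^ (n + m)) w‖ := by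
    rw [hf, hw, complexEnd_pow_complexify, norm_complexify]
  rw [e1, e2]
  have hvq : ‖w‖ ≤ K * ‖q w‖ := by
    have := hKj.le_mul_dist (⟨v, hv⟩ : V) 0
    rw [map_zero, dist_zero_right, dist_zero_right] at this
    rw [hw, norm_complexify]
    exact this
  have b1 : ‖(f ^ n) (p w : Fin d → ℂ)‖ ≤ C₁ * (‖p‖ * K) * C₂ * ‖(f ^ n) (q w : Fin d → ℂ)‖ := by
    have s1 := hb₁ n _ (p w).2
    have s2 := hb₂ n _ (q w).2
    have s3 : ‖(p w : Fin d → ℂ)‖ ≤ ‖p‖ * ‖w‖ := p.le_opNorm w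
    have s4 : θ₁ ^ n ≤ 1 := pow_le_one₀ h0₁.le h1₁.le
    have s5 : θ ^ n ≤ 1 := pow_le_one₀ h0.le h1.le
    have s6 : ‖q w‖ ≤ C₂ * 1 * ‖(f ^ n) (q w : Fin d → ℂ)‖ :=
      s2.trans (by gcongr)
    calc ‖(f ^ n) (p w : Fin d → ℂ)‖ ≤ C₁ * 1 * (‖p‖ * (K * ‖q w‖)) := by
          refine s1.trans ?_
          gcongr
          exact s3.trans (by gcongr)
      _ ≤ C₁ * 1 * (‖p‖ * (K * (C₂ * 1 * ‖(f ^ n) (q w : Fin d → ℂ)‖))) := by gcongr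
      _ = _ := by ring
  have b2 : ‖(f ^ n) w‖ ≤ (C₁ * (‖p‖ * K) * C₂ + 1) * ‖(f ^ n) (q w : Fin d → ℂ)‖ := by
    conv_lhs => rw [← hpq w, map_add]
    refine (norm_add_le _ _).trans ?_
    linarith
  have hmem : (f ^ n) (q w : Fin d → ℂ) ∈ Q := by
    rw [← hcomm]; exact Subtype.prop _
  have b3 : ‖(f ^ n) (q w : Fin d → ℂ)‖ ≤ C₂ * θ ^ m * ((‖q‖ + 1) * ‖(f ^ (n + m)) w‖) := by
    refine (hb₂ m _ hmem).trans ?_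
    rw [← Module.End.mul_apply, ← pow_add, add_comm m n, ← hcomm]
    gcongr
    refine (q.le_opNorm _).trans ?_
    gcongr
    linarith
  calc ‖(f ^ n) w‖ ≤ _ := b2
    _ ≤ (C₁ * (‖p‖ * K) * C₂ + 1) * (C₂ * θ ^ m * ((‖q‖ + 1) * ‖(f ^ (n + m)) w‖)) := by gcongr
    _ = _ := by ring

/-- The determinant of `M ^ n` is a nonzero integer, so `M ^ n` cannot tend to zero. -/
theorem contracted_ne_top {d : ℕ} (hd : 0 < d) {M : Matrix (Fin d) (Fin d) ℤ}
    (hM : IsHyperbolic M) : contracted M ≠ ⊤ := by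
  intro htop
  have : Nonempty (Fin d) := ⟨⟨0, hd⟩⟩
  have h1 : Tendsto (fun n : ℕ => realMat M ^ n) atTop (𝓝 0) := by
    refine tendsto_pi_nhds.2 fun i => tendsto_pi_nhds.2 fun j => ?_
    have h2 := tendsto_mulVec_of_mem_contracted (M := M) (v := Pi.single j 1) (htop ▸ trivial)
    have h3 := (tendsto_pi_nhds.1 h2) i
    simpa using h3
  have h4 : Tendsto (fun n : ℕ => (realMat M ^ n).det) atTop (𝓝 0) := by
    have h5 : Continuous fun A : Matrix (Fin d) (Fin d) ℝ => A.det :=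
      Continuous.matrix_det continuous_id
    have := (h5.tendsto 0).comp h1
    rwa [Matrix.det_zero] at this
  have h6 : ∀ n : ℕ, 1 ≤ ‖(realMat M ^ n).det‖ := by
    intro n
    have h7 : (realMat M).det = (M.det : ℝ) := by
      have := (Int.castRingHom ℝ).map_det M
      simpa [realMat] using this.symm
    rw [Matrix.det_pow, norm_pow, h7]
    refine one_le_pow₀ ?_
    rw [Real.norm_eq_abs]
    exact_mod_cast Int.one_le_abs hM.nonsingular
  have h8 := ge_of_tendsto' h4.norm h6
  simp at h8
  linarith

/-! ### Measures on Cantor sets of grid cubes -/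

/-- `z` is an address of `x`: the point lies in the cube of side `r / N ^ j` with integer corner
`z j` for every `j`, and each cube is one of the children of the previous one which are admitted
by `good`. -/
structure IsAddress {k : ℕ} (N : ℕ) (r : ℝ)
    (good : ℕ → (Fin k → ℤ) → Finset (Fin k → Fin N)) (x : Fin k → ℝ) (z : ℕ → Fin k → ℤ) :
    Prop where
  zero : z 0 = 0
  succ : ∀ j, ∃ g ∈ good j (z j), ∀ i, z (j + 1) i = N * z j i + (g i : ℕ)
  lower : ∀ j i, r / N ^ j * z j i ≤ x i
  upper : ∀ j i, x i ≤ r / N ^ j * (z j i + 1)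

/-- The sequence of grid cubes obtained from a choice `e` of children and a sequence of labels. -/
def cubeSeq {k N M : ℕ} (e : ℕ → (Fin k → ℤ) → Fin M → Fin k → Fin N) (ω : ℕ → Fin M) :
    ℕ → Fin k → ℤ
  | 0 => 0
  | j + 1 => fun i => N * cubeSeq e ω j i + (e j (cubeSeq e ω j) (ω j) i : ℕ)

/-- The point in the intersection of the nested cubes `cubeSeq e ω j`. -/
def cubePoint {k N M : ℕ} (r : ℝ) (e : ℕ → (Fin k → ℤ) → Fin M → Fin k → Fin N)
    (ω : ℕ → Fin M) : Fin k → ℝ :=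
  fun i => ⨆ j : ℕ, r / N ^ j * cubeSeq e ω j i

section Cube

variable {k N M : ℕ} {e : ℕ → (Fin k → ℤ) → Fin M → Fin k → Fin N} {r : ℝ}

theorem monotone_lower (hN : 0 < N) (hr : 0 < r) (ω : ℕ → Fin M) (i : Fin k) :
    Monotone fun j : ℕ => r / N ^ j * cubeSeq e ω j i := by
  refine monotone_nat_of_le_succ fun j => ?_
  have hN' : (0 : ℝ) < N := by exact_mod_cast hN
  simp only [cubeSeq]
  push_cast
  rw [pow_succ]
  have h1 : r / ((N : ℝ) ^ j * N) * (N * cubeSeq e ω j i + ((e j (cubeSeq e ω j) (ω j) i : ℕ) : ℝ))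
      = r / N ^ j * cubeSeq e ω j i
        + r / ((N : ℝ) ^ j * N) * ((e j (cubeSeq e ω j) (ω j) i : ℕ) : ℝ) := by
    field_simp
  rw [h1]
  have : 0 ≤ r / ((N : ℝ) ^ j * N) * ((e j (cubeSeq e ω j) (ω j) i : ℕ) : ℝ) := by positivity
  linarith

theorem antitone_upper (hN : 0 < N) (hr : 0 < r) (ω : ℕ → Fin M) (i : Fin k) :
    Antitone fun j : ℕ => r / N ^ j * ((cubeSeq e ω j i : ℝ) + 1) := by
  refine antitone_nat_of_succ_le fun j => ?_
  have hN' : (0 : ℝ) < N := by exact_mod_cast hN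
  simp only [cubeSeq]
  push_cast
  rw [pow_succ]
  have h0 : ((e j (cubeSeq e ω j) (ω j) i : ℕ) : ℝ) + 1 ≤ N := by
    exact_mod_cast (e j (cubeSeq e ω j) (ω j) i).2
  have h1 : r / (N : ℝ) ^ j * ((cubeSeq e ω j i : ℝ) + 1)
      = r / ((N : ℝ) ^ j * N) * (N * cubeSeq e ω j i + N) := by
    field_simp
  rw [h1]
  gcongr r / ((N : ℝ) ^ j * N) * ?_
  linarith

theorem lower_le_upper (hN : 0 < N) (hr : 0 < r) (ω : ℕ → Fin M) (i : Fin k) (j j' : ℕ) :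
    r / N ^ j * cubeSeq e ω j i ≤ r / N ^ j' * ((cubeSeq e ω j' i : ℝ) + 1) := by
  have hN' : (0 : ℝ) < N := by exact_mod_cast hN
  calc r / N ^ j * cubeSeq e ω j i ≤ r / N ^ (max j j') * cubeSeq e ω (max j j') i :=
        monotone_lower hN hr ω i (le_max_left j j')
    _ ≤ r / N ^ (max j j') * ((cubeSeq e ω (max j j') i : ℝ) + 1) := by
        gcongr
        linarith
    _ ≤ _ := antitone_upper hN hr ω i (le_max_right j j')

theorem isAddress_cubePoint (hN : 0 < N) (hr : 0 < r)
    {good : ℕ → (Fin k → ℤ) → Finset (Fin k → Fin N)} (he : ∀ j z a, e j z a ∈ good j z)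
    (ω : ℕ → Fin M) : IsAddress N r good (cubePoint r e ω) (cubeSeq e ω) where
  zero := rfl
  succ j := ⟨_, he j (cubeSeq e ω j) (ω j), fun _ => rfl⟩
  lower j i := le_ciSup (f := fun j : ℕ => r / N ^ j * (cubeSeq e ω j i : ℝ))
    ⟨_, Set.forall_mem_range.2 fun j => lower_le_upper hN hr ω i j 0⟩ j
  upper j i := ciSup_le fun j' => lower_le_upper hN hr ω i j' j

theorem measurable_cubeSeq (j : ℕ) : Measurable fun ω : ℕ → Fin M => cubeSeq e ω j := by
  induction j with
  | zero => exact measurable_const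
  | succ j ih =>
    have h : Measurable fun p : (Fin k → ℤ) × Fin M =>
        (fun i => N * p.1 i + (e j p.1 p.2 i : ℕ) : Fin k → ℤ) := measurable_of_countable _
    exact h.comp (ih.prodMk (measurable_pi_apply j))

theorem measurable_cubePoint : Measurable (cubePoint (N := N) r e) := by
  refine measurable_pi_lambda _ fun i => Measurable.iSup fun j => ?_
  refine measurable_const.mul ?_
  exact (measurable_of_countable (fun z : ℤ => (z : ℝ))).comp
    ((measurable_pi_apply i).comp (measurable_cubeSeq j))

/-- The cube of generation `j` determines the first `j` labels, by division with remainder. -/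
theorem eq_of_cubeSeq_eq (he : ∀ j z, Function.Injective (e j z)) {ω ω' : ℕ → Fin M} {j : ℕ}
    (h : cubeSeq e ω j = cubeSeq e ω' j) : ∀ i < j, ω i = ω' i := by
  induction j with
  | zero => intro i hi; omega
  | succ j ih =>
    have h1 : ∀ i, (N : ℤ) * cubeSeq e ω j i + (e j (cubeSeq e ω j) (ω j) i : ℕ)
        = N * cubeSeq e ω' j i + (e j (cubeSeq e ω' j) (ω' j) i : ℕ) := fun i => congrFun h i
    have h2 : cubeSeq e ω j = cubeSeq e ω' j := by
      funext i
      have a1 := (e j (cubeSeq e ω j) (ω j) i).2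
      have a2 := (e j (cubeSeq e ω' j) (ω' j) i).2
      have h3 := h1 i
      have hN : (0 : ℤ) < N := by omega
      have b1 := Int.add_mul_ediv_left ((e j (cubeSeq e ω j) (ω j) i : ℕ) : ℤ)
        (cubeSeq e ω j i) hN.ne'
      have b2 := Int.add_mul_ediv_left ((e j (cubeSeq e ω' j) (ω' j) i : ℕ) : ℤ)
        (cubeSeq e ω' j i) hN.ne'
      rw [add_comm, add_comm (N * cubeSeq e ω' j i)] at h3
      rw [h3, b2, Int.ediv_eq_zero_of_lt (by omega) (by omega),
        Int.ediv_eq_zero_of_lt (by omega) (by omega), zero_add, zero_add] at b1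
      exact b1.symm
    intro i hi
    rcases Nat.lt_succ_iff_lt_or_eq.1 hi with hi | rfl
    · exact ih h2 i hi
    · refine he i (cubeSeq e ω i) (funext fun a => Fin.ext ?_)
      have h3 := h1 a
      rw [← h2] at h3
      omega

/-- The law of a sequence of independent uniform labels. -/
def labelMeasure (M : ℕ) [NeZero M] : Measure (ℕ → Fin M) :=
  Measure.infinitePi fun _ => (PMF.uniformOfFintype (Fin M)).toMeasure

instance (M : ℕ) [NeZero M] : IsProbabilityMeasure (labelMeasure M) := by
  unfold labelMeasure; infer_instance

theorem labelMeasure_cubeSeq_le [NeZero M] (he : ∀ j z, Function.Injective (e j z)) (j : ℕ)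
    (z : Fin k → ℤ) :
    labelMeasure M {ω | cubeSeq e ω j = z} ≤ ((M : ENNReal)⁻¹) ^ j := by
  rcases Set.eq_empty_or_nonempty {ω | cubeSeq e ω j = z} with h | ⟨ω₀, h₀⟩
  · rw [h, measure_empty]; exact bot_le
  calc labelMeasure M {ω | cubeSeq e ω j = z}
      ≤ labelMeasure M (Set.pi (Finset.range j) fun i => {ω₀ i}) := by
        refine measure_mono fun ω hω i hi => ?_
        exact eq_of_cubeSeq_eq he ((Set.mem_ofPred.1 hω).trans (Set.mem_ofPred.1 h₀).symm) i
          (Finset.mem_range.1 hi)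
    _ = ∏ i ∈ Finset.range j, (PMF.uniformOfFintype (Fin M)).toMeasure {ω₀ i} := by
        unfold labelMeasure
        exact Measure.infinitePi_pi _ fun i _ => measurableSet_singleton _
    _ = ((M : ENNReal)⁻¹) ^ j := by
        simp

/-- A set of diameter at most the side of the cubes of generation `j` meets at most `4 ^ k` of
them. -/
theorem map_cubePoint_le [NeZero M] (hN : 0 < N) (hr : 0 < r)
    (he : ∀ j z, Function.Injective (e j z)) (j : ℕ) {E : Set (Fin k → ℝ)}
    (hE : Metric.ediam E ≤ ENNReal.ofReal (r / N ^ j)) :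
    (labelMeasure M).map (cubePoint r e) E ≤ 4 ^ k * ((M : ENNReal)⁻¹) ^ j := by
  have hN' : (0 : ℝ) < N := by exact_mod_cast hN
  have hrj : 0 < r / (N : ℝ) ^ j := by positivity
  refine (measure_mono subset_closure).trans ?_
  rw [Measure.map_apply measurable_cubePoint isClosed_closure.measurableSet]
  rw [← Metric.ediam_closure] at hE
  rcases Set.eq_empty_or_nonempty (closure E) with h | ⟨y, hy⟩
  · simp [h]
  set Z : Finset (Fin k → ℤ) := Fintype.piFinset fun i =>
    Finset.Icc (⌊y i / (r / N ^ j)⌋ - 2) (⌊y i / (r / N ^ j)⌋ + 1) with hZ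
  have hcard : Z.card = 4 ^ k := by
    rw [hZ, Fintype.card_piFinset]
    simp only [Int.card_Icc]
    rw [Finset.prod_congr rfl (g := fun _ => 4) (fun i _ => by omega)]
    simp
  have hsub : cubePoint r e ⁻¹' closure E ⊆ ⋃ z ∈ Z, {ω : ℕ → Fin M | cubeSeq e ω j = z} := by
    intro ω hω
    refine Set.mem_iUnion₂.2 ⟨cubeSeq e ω j, Fintype.mem_piFinset.2 fun i => ?_, rfl⟩
    have had := isAddress_cubePoint (e := e) (good := fun _ _ => Finset.univ) hN hr
      (fun _ _ _ => Finset.mem_univ _) ω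
    have h1 := had.lower j i
    have h2 := had.upper j i
    have h3 : |cubePoint r e ω i - y i| ≤ r / N ^ j := by
      have h4 : edist (cubePoint r e ω) y ≤ ENNReal.ofReal (r / N ^ j) :=
        (Metric.edist_le_ediam_of_mem (Set.mem_preimage.1 hω) hy).trans hE
      rw [edist_dist, ENNReal.ofReal_le_ofReal_iff hrj.le] at h4
      exact (Real.dist_eq _ _ ▸ dist_le_pi_dist (cubePoint r e ω) y i).trans h4
    rw [abs_le] at h3
    have h5 : (cubeSeq e ω j i : ℝ) - 1 ≤ y i / (r / N ^ j) := by
      rw [le_div_iff₀ hrj]; linarith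
    have h6 : y i / (r / N ^ j) ≤ (cubeSeq e ω j i : ℝ) + 2 := by
      rw [div_le_iff₀ hrj]; linarith
    rw [Finset.mem_Icc]
    constructor
    · have := (Int.floor_le (y i / (r / N ^ j))).trans h6
      have : ⌊y i / (r / N ^ j)⌋ ≤ cubeSeq e ω j i + 2 := by exact_mod_cast this
      omega
    · have : cubeSeq e ω j i - 1 ≤ ⌊y i / (r / N ^ j)⌋ := Int.le_floor.2 (by push_cast; exact h5)
      omega
  calc labelMeasure M (cubePoint r e ⁻¹' closure E)
      ≤ ∑ z ∈ Z, labelMeasure M {ω | cubeSeq e ω j = z} :=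
        (measure_mono hsub).trans (measure_biUnion_finset_le _ _)
    _ ≤ ∑ z ∈ Z, ((M : ENNReal)⁻¹) ^ j :=
        Finset.sum_le_sum fun z _ => labelMeasure_cubeSeq_le he j z
    _ = 4 ^ k * ((M : ENNReal)⁻¹) ^ j := by
        rw [Finset.sum_const, hcard, nsmul_eq_mul]; push_cast; rfl

end Cube

/-- If every grid cube has at least `N ^ s` admitted children, then the points with an admitted
address carry a probability measure of dimension at least `s`. -/
theorem exists_measure_isAddress {k N M : ℕ} (hN : 2 ≤ N) {s r : ℝ} (hs : 0 < s) (hr : 0 < r)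
    (hM : (N : ℝ) ^ s ≤ M) (good : ℕ → (Fin k → ℤ) → Finset (Fin k → Fin N))
    (hgood : ∀ j z, M ≤ (good j z).card) :
    ∃ ν : Measure (Fin k → ℝ), IsProbabilityMeasure ν ∧
      (∀ A : Set (Fin k → ℝ), (∀ x z, IsAddress N r good x z → x ∈ A) → ν A = 1) ∧
      ∃ C : ENNReal, C ≠ ⊤ ∧ ∀ E, ν E ≤ C * Metric.ediam E ^ s := by
  have hN1 : (1 : ℝ) < N := by exact_mod_cast (by omega : 1 < N)
  have hN0 : (0 : ℝ) < N := by linarith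
  have hNs : 1 < (N : ℝ) ^ s := Real.one_lt_rpow hN1 hs
  have hM1 : (1 : ℝ) < M := hNs.trans_le hM
  have hM0 : M ≠ 0 := by rintro rfl; norm_num at hM1
  have : NeZero M := ⟨hM0⟩
  have hemb : ∀ j z, ∃ e : Fin M → Fin k → Fin N, Function.Injective e ∧ ∀ a, e a ∈ good j z := by
    intro j z
    obtain ⟨f⟩ := Function.Embedding.nonempty_of_card_le (α := Fin M) (β := good j z)
      (by simpa using hgood j z)
    exact ⟨fun a => f a, fun a b h => f.injective (Subtype.ext h), fun a => (f a).2⟩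
  choose e he he' using hemb
  have hbound : ∀ (j : ℕ) (E : Set (Fin k → ℝ)),
      Metric.ediam E ≤ ENNReal.ofReal (r / N ^ j) →
      (labelMeasure M).map (cubePoint r e) E ≤ ENNReal.ofReal (4 ^ k * ((N : ℝ) ^ s)⁻¹ ^ j) := by
    intro j E hE
    refine (map_cubePoint_le (by omega) hr he j hE).trans ?_
    rw [ENNReal.ofReal_mul (by positivity), ENNReal.ofReal_pow (by positivity),
      ENNReal.ofReal_pow (by positivity), ENNReal.ofReal_inv_of_pos (by positivity)]
    gcongr
    · simp
    · rw [← ENNReal.ofReal_natCast]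
      exact ENNReal.ofReal_le_ofReal hM
  have hprob : IsProbabilityMeasure ((labelMeasure M).map (cubePoint r e)) :=
    Measure.isProbabilityMeasure_map measurable_cubePoint.aemeasurable
  refine ⟨(labelMeasure M).map (cubePoint r e), hprob, ?_, ?_⟩
  · intro A hA
    refine le_antisymm prob_le_one ?_
    have h1 := Measure.le_map_apply (μ := labelMeasure M)
      (measurable_cubePoint (r := r) (e := e)).aemeasurable A
    have h2 : cubePoint r e ⁻¹' A = Set.univ := Set.eq_univ_of_forall fun ω =>
      hA _ _ (isAddress_cubePoint (by omega) hr he' ω)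
    rwa [h2, measure_univ] at h1
  · refine ⟨ENNReal.ofReal (4 ^ k * (N / r) ^ s), ENNReal.ofReal_ne_top, fun E => ?_⟩
    have hC : 0 < 4 ^ k * ((N : ℝ) / r) ^ s := by positivity
    rcases eq_or_ne (Metric.ediam E) ⊤ with htop | htop
    · rw [htop, ENNReal.top_rpow_of_pos hs, ENNReal.mul_top (by simpa using hC)]
      exact le_top
    obtain ⟨t, ht0, ht⟩ : ∃ t : ℝ, 0 ≤ t ∧ Metric.ediam E = ENNReal.ofReal t :=
      ⟨_, ENNReal.toReal_nonneg, (ENNReal.ofReal_toReal htop).symm⟩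
    rw [ht, ENNReal.ofReal_rpow_of_nonneg ht0 hs.le, ← ENNReal.ofReal_mul hC.le]
    rcases ht0.eq_or_lt with rfl | htpos
    · -- a set of diameter zero is below every scale
      have hlim : Tendsto (fun j : ℕ => ENNReal.ofReal (4 ^ k * ((N : ℝ) ^ s)⁻¹ ^ j)) atTop
          (𝓝 0) := by
        rw [← ENNReal.ofReal_zero]
        refine ENNReal.tendsto_ofReal ?_
        have := (tendsto_pow_atTop_nhds_zero_of_lt_one (r := ((N : ℝ) ^ s)⁻¹) (by positivity)
          (inv_lt_one_of_one_lt₀ hNs)).const_mul ((4 : ℝ) ^ k)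
        simpa using this
      refine (ge_of_tendsto' hlim fun j => hbound j E ?_).trans bot_le
      rw [ht]
      exact ENNReal.ofReal_le_ofReal (by positivity)
    rcases le_or_gt t r with htr | htr
    · obtain ⟨j, hj1, hj2⟩ := exists_nat_pow_near ((one_le_div htpos).2 htr) hN1
      refine (hbound j E ?_).trans (ENNReal.ofReal_le_ofReal ?_)
      · rw [ht]
        refine ENNReal.ofReal_le_ofReal ?_
        rw [le_div_iff₀ (by positivity)]
        rw [le_div_iff₀ htpos] at hj1
        linarith
      · rw [mul_assoc, ← Real.mul_rpow (by positivity) ht0, inv_pow, ← Real.rpow_natCast ((N : ℝ) ^ s) j,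
          ← Real.rpow_mul hN0.le, mul_comm s, Real.rpow_mul hN0.le, Real.rpow_natCast,
          ← Real.inv_rpow (by positivity)]
        gcongr
        rw [div_lt_iff₀ htpos, pow_succ] at hj2
        rw [inv_le_iff_one_le_mul₀ (by positivity)]
        have : (N : ℝ) / r * t * N ^ j = (N ^ j * N * t) / r := by ring
        rw [this, one_le_div hr]
        exact hj2.le
    · refine prob_le_one.trans ?_
      rw [← ENNReal.ofReal_one]
      refine ENNReal.ofReal_le_ofReal ?_
      rw [mul_assoc, ← Real.mul_rpow (by positivity) ht0]
      have h1 : 1 ≤ (N : ℝ) / r * t := by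
        rw [div_mul_eq_mul_div, one_le_div hr]
        nlinarith
      have h2 := Real.one_le_rpow h1 hs.le
      have h3 : (1 : ℝ) ≤ 4 ^ k := one_le_pow₀ (by norm_num)
      nlinarith

/-! ### Avoiding the integer points along an expanding sequence of linear maps -/

/-- Counts grid positions line by line in the direction `l`, each line carrying at most `c + 1`. -/
theorem card_le_of_fiber_osc {k N : ℕ} (B : Finset (Fin k → Fin N)) (l : Fin k) (c : ℕ)
    (h : ∀ g ∈ B, ∀ g' ∈ B, (∀ i, i ≠ l → g i = g' i) → (g l : ℕ) ≤ g' l + c) :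
    B.card ≤ (c + 1) * N ^ (k - 1) := by
  classical
  set f : (Fin k → Fin N) → ({i : Fin k // i ≠ l} → Fin N) := fun g i => g i with hf
  have h1 : B.card ≤ (c + 1) * (B.image f).card := by
    refine Finset.card_le_mul_card_image B (c + 1) fun b _ => ?_
    rcases Finset.eq_empty_or_nonempty (B.filter fun g => f g = b) with h0 | h0
    · rw [h0]; simp
    obtain ⟨g₀, hg₀, hmin⟩ := Finset.exists_min_image _ (fun g : Fin k → Fin N => (g l : ℕ)) h0
    rw [Finset.mem_filter] at hg₀
    have h2 : (B.filter fun g => f g = b).card ≤ (Finset.Icc (g₀ l : ℕ) (g₀ l + c)).card := by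
      refine Finset.card_le_card_of_injOn (fun g => (g l : ℕ)) ?_ ?_
      · intro g hg
        have hg' := Finset.mem_filter.1 (Finset.mem_coe.1 hg)
        refine Finset.mem_coe.2 (Finset.mem_Icc.2 ⟨hmin g (Finset.mem_coe.1 hg), ?_⟩)
        exact h g hg'.1 g₀ hg₀.1 fun i hi => congrFun (hg'.2.trans hg₀.2.symm) ⟨i, hi⟩
      · intro g hg g' hg' hgg
        have hg1 := Finset.mem_filter.1 (Finset.mem_coe.1 hg)
        have hg2 := Finset.mem_filter.1 (Finset.mem_coe.1 hg')
        funext i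
        by_cases hi : i = l
        · subst hi; exact Fin.ext hgg
        · exact congrFun (hg1.2.trans hg2.2.symm) ⟨i, hi⟩
    rw [Nat.card_Icc] at h2
    omega
  refine h1.trans (Nat.mul_le_mul_left _ ?_)
  refine (Finset.card_le_univ _).trans ?_
  simp [Fintype.card_subtype_compl]

/-- The linear map with coefficients `A`. -/
def linMap {d k : ℕ} (A : Fin d → Fin k → ℝ) (x : Fin k → ℝ) : Fin d → ℝ :=
  fun i => ∑ l, A i l * x l

theorem abs_coeff_le {d k : ℕ} (A : Fin d → Fin k → ℝ) (i : Fin d) (l : Fin k) :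
    |A i l| ≤ ‖A‖ :=
  (norm_le_pi_norm (A i) l).trans (norm_le_pi_norm A i)

theorem exists_norm_le_abs_coeff {d k : ℕ} {A : Fin d → Fin k → ℝ} (h : 0 < ‖A‖) :
    ∃ i l, ‖A‖ ≤ |A i l| := by
  by_contra! h1
  have h2 : ‖A‖ < ‖A‖ := (pi_norm_lt_iff h).2 fun i => (pi_norm_lt_iff h).2 fun l => h1 i l
  exact lt_irrefl _ h2

theorem abs_linMap_sub_le {d k : ℕ} (A : Fin d → Fin k → ℝ) {x y : Fin k → ℝ} {t : ℝ}
    (h : ∀ l, |x l - y l| ≤ t) (i : Fin d) : |linMap A x i - linMap A y i| ≤ k * ‖A‖ * t := by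
  have h1 : linMap A x i - linMap A y i = ∑ l, A i l * (x l - y l) := by
    simp only [linMap, mul_sub, Finset.sum_sub_distrib]
  rw [h1]
  refine (Finset.abs_sum_le_sum_abs _ _).trans ?_
  calc ∑ l, |A i l * (x l - y l)| ≤ ∑ _l : Fin k, ‖A‖ * t := by
        refine Finset.sum_le_sum fun l _ => ?_
        rw [abs_mul]
        exact mul_le_mul (abs_coeff_le A i l) (h l) (abs_nonneg _) (norm_nonneg _)
    _ = k * ‖A‖ * t := by simp; ring

/-- The cube `ρ * (z + [0, 1] ^ k)` contains a point which the linear map sends into the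
`δ`-neighbourhood of the integer points. -/
def MeetsInteger {d k : ℕ} (A : Fin d → Fin k → ℝ) (δ ρ : ℝ) (z : Fin k → ℤ) : Prop :=
  ∃ x : Fin k → ℝ, (∀ i, ρ * z i ≤ x i ∧ x i ≤ ρ * (z i + 1)) ∧
    ∃ m : Fin d → ℤ, ∀ i, |linMap A x i - m i| < δ

/-- The image of the parent cube, of side `N * ρ`, is so small that only one integer point is
relevant. The children meeting its neighbourhood therefore lie in a slab transverse to the
coordinate of the largest coefficient, of thickness comparable to the side of the children. -/
theorem card_meetsInteger_le {d k N : ℕ} {A : Fin d → Fin k → ℝ} {δ ρ : ℝ} (hA : 0 < ‖A‖)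
    (hρ : 0 < ρ) (hδ : δ ≤ 1 / 4) (hδρ : 2 * δ ≤ ‖A‖ * ρ) (hside : k * ‖A‖ * (N * ρ) ≤ 1 / 4)
    (z : Fin k → ℤ) (B : Finset (Fin k → Fin N))
    (hB : ∀ g ∈ B, MeetsInteger A δ ρ (fun i => N * z i + (g i : ℕ))) :
    B.card ≤ (k + 3) * N ^ (k - 1) := by
  obtain ⟨i₀, l, hl⟩ := exists_norm_le_abs_coeff hA
  refine card_le_of_fiber_osc B l (k + 2) fun g hg g' hg' hgg => ?_
  obtain ⟨x, hx, m, hm⟩ := hB g hg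
  obtain ⟨y, hy, m', hm'⟩ := hB g' hg'
  push_cast at hx hy
  have hpar : ∀ i, |x i - y i| ≤ N * ρ := by
    intro i
    have h1 : ((g i : ℕ) : ℝ) + 1 ≤ N := by exact_mod_cast (g i).2
    have h2 : ((g' i : ℕ) : ℝ) + 1 ≤ N := by exact_mod_cast (g' i).2
    have h3 : (0 : ℝ) ≤ ((g i : ℕ) : ℝ) := Nat.cast_nonneg _
    have h4 : (0 : ℝ) ≤ ((g' i : ℕ) : ℝ) := Nat.cast_nonneg _
    have := hx i
    have := hy i
    rw [abs_le]
    constructor <;> nlinarith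
  have hmm : m = m' := by
    funext i
    have h1 := (abs_linMap_sub_le A hpar i).trans hside
    have h2 := hm i
    have h3 := hm' i
    have h4 : |(m i : ℝ) - m' i| < 1 := by
      rw [abs_lt] at *
      rw [abs_le] at h1
      constructor <;> linarith
    have h5 : |m i - m' i| < 1 := by exact_mod_cast h4
    rw [Int.abs_lt_one_iff] at h5
    omega
  subst hmm
  -- move `x` in the direction `l` to the cube of `y`
  set u : Fin k → ℝ := fun i => x i - ρ * (((g i : ℕ) : ℝ) - (g' i : ℕ)) with hu
  have hu1 : ∀ i, |u i - y i| ≤ ρ := by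
    intro i
    have h1 := hx i
    have h2 := hy i
    simp only [hu]
    rw [abs_le]
    constructor <;> nlinarith
  have h1 := abs_linMap_sub_le A hu1 i₀
  have h2 : linMap A x i₀ - linMap A u i₀ = A i₀ l * (ρ * (((g l : ℕ) : ℝ) - (g' l : ℕ))) := by
    simp only [linMap, ← Finset.sum_sub_distrib, ← mul_sub]
    rw [Finset.sum_eq_single l]
    · simp [hu]
    · intro i _ hi
      simp [hu, hgg i hi]
    · intro h; exact absurd (Finset.mem_univ _) h
  have h3 : |A i₀ l * (ρ * (((g l : ℕ) : ℝ) - (g' l : ℕ)))| ≤ ‖A‖ * ρ * (k + 1) := by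
    rw [← h2]
    have h4 := hm i₀
    have h5 := hm' i₀
    rw [abs_lt] at h4 h5
    rw [abs_le] at h1 ⊢
    constructor <;> nlinarith
  rw [abs_mul, abs_mul, abs_of_pos hρ] at h3
  have h6 : ‖A‖ * ρ * |((g l : ℕ) : ℝ) - (g' l : ℕ)| ≤ ‖A‖ * ρ * (k + 1) := by
    refine le_trans ?_ h3
    rw [mul_assoc]
    gcongr
  have h7 := le_of_mul_le_mul_left h6 (by positivity)
  have h8 : ((g l : ℕ) : ℝ) ≤ (g' l : ℕ) + (k + 1) := by
    have := (abs_le.1 h7).2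
    linarith
  have h9 : (g l : ℕ) ≤ g' l + (k + 1) := by exact_mod_cast h8
  omega

/-- Choice of the grid: logarithmically many slabs per generation remove a negligible proportion
of the children. -/
theorem exists_grid_parameters {k : ℕ} (hk : 0 < k) {C θ s : ℝ} (hC : 0 < C) (h0 : 0 < θ)
    (h1 : θ < 1) (hs : s < k) :
    ∃ N L : ℕ, 2 ≤ N ∧ (∀ q : ℕ, 1 ≤ C * θ ^ q * N → q ≤ L) ∧
      (N : ℝ) ^ s + (((L + 1) * ((k + 3) * N ^ (k - 1)) : ℕ) : ℝ) ≤ (N : ℝ) ^ k := by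
  have hlθ : 0 < -Real.log θ := by linarith [Real.log_neg h0 h1]
  set F : ℕ → ℝ := fun N => (Real.log C + Real.log N) / (-Real.log θ) with hF
  have hlogN : Tendsto (fun N : ℕ => Real.log N / N) atTop (𝓝 0) := by
    have := (Real.isLittleO_log_id_atTop.tendsto_div_nhds_zero).comp
      (tendsto_natCast_atTop_atTop (R := ℝ))
    exact this
  have hinv : Tendsto (fun N : ℕ => ((N : ℝ))⁻¹) atTop (𝓝 0) :=
    tendsto_inv_atTop_zero.comp tendsto_natCast_atTop_atTop
  have hF0 : Tendsto (fun N : ℕ => F N / N) atTop (𝓝 0) := by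
    have := ((hinv.const_mul (Real.log C)).add hlogN).div_const (-Real.log θ)
    simp only [mul_zero, add_zero, zero_div] at this
    refine this.congr fun N => ?_
    simp only [hF]; ring
  have hpow : Tendsto (fun N : ℕ => (N : ℝ) ^ (s - k)) atTop (𝓝 0) := by
    have := (tendsto_rpow_neg_atTop (y := k - s) (by linarith)).comp
      (tendsto_natCast_atTop_atTop (R := ℝ))
    refine this.congr fun N => ?_
    simp
  have htot : Tendsto (fun N : ℕ => (N : ℝ) ^ (s - k) + (|F N / N| + (N : ℝ)⁻¹) * (k + 3)) atTop
      (𝓝 0) := by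
    have := hpow.add ((hF0.abs.add hinv).mul_const ((k : ℝ) + 3))
    simpa using this
  obtain ⟨N, hN, hN2⟩ := ((htot.eventually (gt_mem_nhds one_pos)).and
    (eventually_ge_atTop 2)).exists
  have hN0 : (0 : ℝ) < N := by exact_mod_cast (by omega : 0 < N)
  refine ⟨N, ⌊F N⌋₊, hN2, fun q hq => Nat.le_floor ?_, ?_⟩
  · have h2 := Real.log_le_log one_pos hq
    rw [Real.log_one, Real.log_mul (by positivity) hN0.ne', Real.log_mul hC.ne' (by positivity),
      Real.log_pow] at h2
    simp only [hF]
    rw [le_div_iff₀ hlθ]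
    linarith
  · have hfl : (⌊F N⌋₊ : ℝ) ≤ |F N| := by
      rcases le_total 0 (F N) with h | h
      · exact (Nat.floor_le h).trans (le_abs_self _)
      · rw [Nat.floor_of_nonpos h]; simp
    push_cast
    have hNk : (N : ℝ) ^ k = N ^ (k - 1) * N := by
      rw [← pow_succ, Nat.sub_add_cancel hk]
    have e1 : (N : ℝ) ^ s = N ^ k * (N : ℝ) ^ (s - k) := by
      rw [Real.rpow_sub hN0, Real.rpow_natCast]
      field_simp
    have e2 : ((⌊F N⌋₊ : ℝ) + 1) * ((k + 3) * N ^ (k - 1))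
        ≤ N ^ k * ((|F N / N| + (N : ℝ)⁻¹) * (k + 3)) := by
      rw [abs_div, abs_of_pos hN0, hNk]
      have : (N : ℝ) ^ (k - 1) * N * ((|F N| / N + (N : ℝ)⁻¹) * (k + 3))
          = (|F N| + 1) * ((k + 3) * N ^ (k - 1)) := by
        field_simp
      rw [this]
      gcongr
    rw [e1]
    calc _ ≤ (N : ℝ) ^ k * (N : ℝ) ^ (s - k)
          + N ^ k * ((|F N / N| + (N : ℝ)⁻¹) * (k + 3)) := by gcongr
      _ = (N : ℝ) ^ k * ((N : ℝ) ^ (s - k) + (|F N / N| + (N : ℝ)⁻¹) * (k + 3)) := by ring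
      _ ≤ (N : ℝ) ^ k * 1 := by gcongr
      _ = _ := mul_one _

/-- For an exponentially expanding sequence of linear maps there are measures of dimension
arbitrarily close to the full one carried by points whose images stay away from the integer
points. -/
theorem exists_measure_avoiding {d k : ℕ} (hk : 0 < k) (A : ℕ → Fin d → Fin k → ℝ) {C θ : ℝ}
    (hC : 0 < C) (h0 : 0 < θ) (h1 : θ < 1) (hA0 : 0 < ‖A 0‖)
    (hA : ∀ n m, ‖A n‖ ≤ C * θ ^ m * ‖A (n + m)‖) {s R : ℝ} (hs0 : 0 < s) (hs : s < k)
    (hR : 0 < R) :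
    ∃ δ > 0, ∃ ν : Measure (Fin k → ℝ), IsProbabilityMeasure ν ∧
      ν {x | (∀ i, |x i| ≤ R) ∧ ∀ n, ∀ m : Fin d → ℤ, ∃ i, δ ≤ |linMap (A n) x i - m i|} = 1 ∧
      ∃ D : ENNReal, D ≠ ⊤ ∧ ∀ E, ν E ≤ D * Metric.ediam E ^ s := by
  classical
  obtain ⟨N, L, hN, hL, hNL⟩ := exists_grid_parameters hk hC h0 h1 hs
  have hN0 : (0 : ℝ) < N := by exact_mod_cast (by omega : 0 < N)
  have hk0 : (0 : ℝ) < k := by exact_mod_cast hk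
  set β : ℝ := ‖A 0‖ / C with hβ
  have hβ0 : 0 < β := by positivity
  have hβA : ∀ n, β ≤ ‖A n‖ := by
    intro n
    rw [hβ, div_le_iff₀ hC]
    have := hA 0 n
    rw [zero_add] at this
    have h2 : θ ^ n ≤ 1 := pow_le_one₀ h0.le h1.le
    calc ‖A 0‖ ≤ C * θ ^ n * ‖A n‖ := this
      _ ≤ C * 1 * ‖A n‖ := by gcongr
      _ = _ := by ring
  have hAn : ∀ n, 0 < ‖A n‖ := fun n => hβ0.trans_le (hβA n)
  -- the maps whose size is tuned to the cubes of generation `j`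
  set cl : ℕ → ℕ → Prop := fun j n => β * N ^ j ≤ ‖A n‖ ∧ ‖A n‖ < β * N ^ (j + 1) with hcl
  have hclex : ∀ n, ∃ j, cl j n := by
    intro n
    obtain ⟨j, hj1, hj2⟩ := exists_nat_pow_near ((one_le_div hβ0).2 (hβA n))
      (show (1 : ℝ) < N by exact_mod_cast (by omega : 1 < N))
    rw [le_div_iff₀ hβ0] at hj1
    rw [div_lt_iff₀ hβ0] at hj2
    exact ⟨j, by linarith, by linarith⟩
  have hclL : ∀ j, ∃ n₀, ∀ n, cl j n → n ∈ Finset.Icc n₀ (n₀ + L) := by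
    intro j
    by_cases hex : ∃ n, cl j n
    · refine ⟨Nat.find hex, fun n hn => ?_⟩
      have hle := Nat.find_min' hex hn
      have hsp := Nat.find_spec hex
      obtain ⟨q, rfl⟩ := Nat.exists_eq_add_of_le hle
      refine Finset.mem_Icc.2 ⟨hle, Nat.add_le_add_left (hL q ?_) _⟩
      have h2 := hsp.1.trans (hA (Nat.find hex) q)
      have h3 : C * θ ^ q * ‖A (Nat.find hex + q)‖ ≤ C * θ ^ q * (β * N ^ (j + 1)) := by
        gcongr
        exact hn.2.le
      have h4 := h2.trans h3
      rw [pow_succ] at h4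
      have h5 : β * (N : ℝ) ^ j * 1 ≤ β * N ^ j * (C * θ ^ q * N) := by
        calc _ = β * (N : ℝ) ^ j := mul_one _
          _ ≤ _ := h4
          _ = _ := by ring
      exact le_of_mul_le_mul_left h5 (by positivity)
    · push Not at hex
      exact ⟨0, fun n hn => absurd hn (hex n)⟩
  -- the image under `A n` of a cube of generation `j` has diameter at most `1 / 4` if `cl j n`
  set r : ℝ := min R (1 / (4 * k * β * N)) with hr
  have hr0 : 0 < r := lt_min hR (by positivity)
  have hrR : r ≤ R := min_le_left _ _
  have hrβ : k * β * N * r ≤ 1 / 4 := by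
    have : r ≤ 1 / (4 * k * β * N) := min_le_right _ _
    calc k * β * N * r ≤ k * β * N * (1 / (4 * k * β * N)) := by gcongr
      _ = 1 / 4 := by field_simp
  -- the slabs are no thicker than the children of the cube
  set δ : ℝ := min (1 / 4) (β * r / (2 * N)) with hδ
  have hδ0 : 0 < δ := lt_min (by norm_num) (by positivity)
  set good : ℕ → (Fin k → ℤ) → Finset (Fin k → Fin N) := fun j z =>
    Finset.univ.filter fun g => ∀ n, cl j n →
      ¬ MeetsInteger (A n) δ (r / N ^ (j + 1)) (fun i => N * z i + (g i : ℕ)) with hgood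
  set M : ℕ := N ^ k - (L + 1) * ((k + 3) * N ^ (k - 1)) with hM
  have hcard : ∀ j z, M ≤ (good j z).card := by
    intro j z
    obtain ⟨n₀, hn₀⟩ := hclL j
    set bad : ℕ → Finset (Fin k → Fin N) := fun n =>
      Finset.univ.filter fun g =>
        MeetsInteger (A n) δ (r / N ^ (j + 1)) (fun i => N * z i + (g i : ℕ)) with hbad
    have hsub : Finset.univ ⊆ good j z ∪
        ((Finset.Icc n₀ (n₀ + L)).filter (cl j)).biUnion bad := by
      intro g _
      by_cases hg : ∀ n, cl j n →
          ¬ MeetsInteger (A n) δ (r / N ^ (j + 1)) (fun i => N * z i + (g i : ℕ))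
      · exact Finset.mem_union_left _ (Finset.mem_filter.2 ⟨Finset.mem_univ _, hg⟩)
      · push Not at hg
        obtain ⟨n, hn, hg⟩ := hg
        exact Finset.mem_union_right _ (Finset.mem_biUnion.2
          ⟨n, Finset.mem_filter.2 ⟨hn₀ n hn, hn⟩, Finset.mem_filter.2 ⟨Finset.mem_univ _, hg⟩⟩)
    have hb : (((Finset.Icc n₀ (n₀ + L)).filter (cl j)).biUnion bad).card
        ≤ (L + 1) * ((k + 3) * N ^ (k - 1)) := by
      refine (Finset.card_biUnion_le_card_mul _ _ ((k + 3) * N ^ (k - 1)) fun n hn => ?_).trans ?_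
      · have hn' := (Finset.mem_filter.1 hn).2
        have hNj : (0 : ℝ) < N ^ j := by positivity
        refine card_meetsInteger_le (hAn n) (by positivity) (min_le_left _ _) ?_ ?_ z _
          fun g hg => (Finset.mem_filter.1 hg).2
        · have h2 : δ ≤ β * r / (2 * N) := min_le_right _ _
          calc 2 * δ ≤ 2 * (β * r / (2 * N)) := by gcongr
            _ = (β * N ^ j) * (r / N ^ (j + 1)) := by rw [pow_succ]; field_simp
            _ ≤ ‖A n‖ * (r / N ^ (j + 1)) := by gcongr; exact hn'.1
        · calc k * ‖A n‖ * (N * (r / N ^ (j + 1)))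
              ≤ k * (β * N ^ (j + 1)) * (N * (r / N ^ (j + 1))) := by
                gcongr; exact hn'.2.le
            _ = k * β * N * r := by field_simp
            _ ≤ 1 / 4 := hrβ
      · refine Nat.mul_le_mul_right _ ((Finset.card_filter_le _ _).trans ?_)
        rw [Nat.card_Icc]; omega
    have h2 := (Finset.card_le_card hsub).trans (Finset.card_union_le _ _)
    rw [Finset.card_univ, Fintype.card_fun, Fintype.card_fin, Fintype.card_fin] at h2
    omega
  have hMs : (N : ℝ) ^ s ≤ M := by
    have h2 : ((N ^ k : ℕ) : ℝ) ≤ ((M + (L + 1) * ((k + 3) * N ^ (k - 1)) : ℕ) : ℝ) := by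
      exact_mod_cast le_tsub_add
    push_cast at h2 hNL
    linarith
  obtain ⟨ν, hν, hνA, D, hD, hνD⟩ := exists_measure_isAddress hN hs0 hr0 hMs good hcard
  refine ⟨δ, hδ0, ν, hν, hνA _ ?_, D, hD, hνD⟩
  intro x z hz
  refine ⟨fun i => ?_, fun n m => ?_⟩
  · have h2 := hz.lower 0 i
    have h3 := hz.upper 0 i
    rw [hz.zero] at h2 h3
    simp at h2 h3
    rw [abs_of_nonneg h2]
    exact h3.trans hrR
  · obtain ⟨j, hj⟩ := hclex n
    obtain ⟨g, hg, hzg⟩ := hz.succ j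
    by_contra! hcon
    refine (Finset.mem_filter.1 hg).2 n hj ⟨x, fun i => ?_, m, hcon⟩
    beta_reduce
    rw [← hzg i]
    exact ⟨hz.lower (j + 1) i, hz.upper (j + 1) i⟩

/-! ### Almost every orbit equidistributes -/

/-- Averages of a bounded sequence converge as soon as they converge along the squares. -/
theorem tendsto_average_of_tendsto_average_sq {a : ℕ → ℂ} (ha : ∀ n, ‖a n‖ ≤ 1)
    (h : Tendsto (fun m : ℕ => ‖∑ n ∈ Finset.range (m ^ 2), a n‖ / (m : ℝ) ^ 2) atTop (𝓝 0)) :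
    Tendsto (fun N : ℕ => (N : ℂ)⁻¹ * ∑ n ∈ Finset.range N, a n) atTop (𝓝 0) := by
  have hsq : Tendsto Nat.sqrt atTop atTop :=
    tendsto_atTop_atTop.2 fun b => ⟨b * b, fun n hn => Nat.le_sqrt.2 hn⟩
  have h2 : Tendsto (fun m : ℕ => 2 * (m : ℝ)⁻¹) atTop (𝓝 0) := by
    simpa using (tendsto_inv_atTop_zero.comp (tendsto_natCast_atTop_atTop (R := ℝ))).const_mul 2
  have h3 := (h.add h2).comp hsq
  rw [add_zero] at h3
  refine squeeze_zero_norm' ?_ h3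
  filter_upwards [eventually_ge_atTop 1] with N hN
  simp only [Function.comp]
  set m := Nat.sqrt N with hm
  have hm1 : 1 ≤ m := Nat.le_sqrt.2 (by simpa using hN)
  have hmN : m ^ 2 ≤ N := Nat.sqrt_le' N
  have hNm : N ≤ m ^ 2 + 2 * m := by
    have := Nat.sqrt_le_add N
    rw [pow_two, hm]; omega
  have hm0 : (0 : ℝ) < m := by exact_mod_cast hm1
  have hmN' : (m : ℝ) ^ 2 ≤ N := by exact_mod_cast hmN
  have hsum : ‖∑ n ∈ Finset.range N, a n‖
      ≤ ‖∑ n ∈ Finset.range (m ^ 2), a n‖ + 2 * m := by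
    rw [← Finset.sum_range_add_sum_Ico _ hmN]
    refine (norm_add_le _ _).trans (add_le_add le_rfl ?_)
    refine (norm_sum_le _ _).trans ((Finset.sum_le_sum fun n _ => ha n).trans ?_)
    simp only [Finset.sum_const, Nat.card_Ico, nsmul_eq_mul, mul_one]
    exact_mod_cast (by omega : N - m ^ 2 ≤ 2 * m)
  rw [norm_mul, norm_inv, Complex.norm_natCast]
  calc (N : ℝ)⁻¹ * ‖∑ n ∈ Finset.range N, a n‖
      ≤ ((m : ℝ) ^ 2)⁻¹ * (‖∑ n ∈ Finset.range (m ^ 2), a n‖ + 2 * m) := by gcongr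
    _ = _ := by field_simp

/-- A strong law of large numbers: bounded functions whose partial sums have second moments
growing at most linearly average to zero almost everywhere. -/
theorem ae_tendsto_average_zero {X : Type*} [MeasurableSpace X] {μ : Measure X}
    [IsProbabilityMeasure μ] {u : ℕ → X → ℂ} (hu : ∀ n, Measurable (u n))
    (hu1 : ∀ n x, ‖u n x‖ ≤ 1)
    (h2 : ∀ N : ℕ, ∫ x, ‖∑ n ∈ Finset.range N, u n x‖ ^ 2 ∂μ ≤ N) :
    ∀ᵐ x ∂μ, Tendsto (fun N : ℕ => (N : ℂ)⁻¹ * ∑ n ∈ Finset.range N, u n x) atTop (𝓝 0) := by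
  set G : ℕ → X → ENNReal := fun m x =>
    ENNReal.ofReal ((‖∑ n ∈ Finset.range (m ^ 2), u n x‖ / (m : ℝ) ^ 2) ^ 2) with hG
  have hmeas : ∀ N : ℕ, Measurable fun x => ‖∑ n ∈ Finset.range N, u n x‖ := fun N =>
    (Finset.measurable_sum _ fun n _ => hu n).norm
  have hGm : ∀ m, Measurable (G m) := fun m =>
    ENNReal.measurable_ofReal.comp (((hmeas _).div_const _).pow_const 2)
  have hbd : ∀ N : ℕ, ∀ x, ‖∑ n ∈ Finset.range N, u n x‖ ≤ N := fun N x => by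
    refine (norm_sum_le _ _).trans ((Finset.sum_le_sum fun n _ => hu1 n x).trans ?_)
    simp
  have hint : ∀ m, ∫⁻ x, G m x ∂μ ≤ ENNReal.ofReal (1 / (m : ℝ) ^ 2) := by
    intro m
    have hi : Integrable (fun x => (‖∑ n ∈ Finset.range (m ^ 2), u n x‖ / (m : ℝ) ^ 2) ^ 2) μ := by
      refine Integrable.of_bound (((hmeas _).div_const _).pow_const 2).aestronglyMeasurable
        ((((m ^ 2 : ℕ) : ℝ) / (m : ℝ) ^ 2) ^ 2) (Eventually.of_forall fun x => ?_)
      rw [Real.norm_of_nonneg (by positivity)]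
      gcongr
      exact hbd _ x
    rw [← ofReal_integral_eq_lintegral_ofReal hi (Eventually.of_forall fun x => by positivity)]
    refine ENNReal.ofReal_le_ofReal ?_
    simp only [div_pow]
    rw [integral_div]
    have := h2 (m ^ 2)
    push_cast at this
    rcases Nat.eq_zero_or_pos m with rfl | hm
    · simp
    have hm0 : (0 : ℝ) < m := by exact_mod_cast hm
    rw [div_le_div_iff₀ (by positivity) (by positivity)]
    calc _ ≤ (m : ℝ) ^ 2 * (m : ℝ) ^ 2 := by gcongr
      _ = _ := by ring
  have hfin : ∫⁻ x, ∑' m, G m x ∂μ ≠ ⊤ := by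
    rw [lintegral_tsum fun m => (hGm m).aemeasurable]
    refine ne_top_of_le_ne_top ?_ (ENNReal.tsum_le_tsum hint)
    exact (Real.summable_one_div_nat_pow.2 one_lt_two).tsum_ofReal_ne_top
  filter_upwards [ae_lt_top' (AEMeasurable.tsum fun m => (hGm m).aemeasurable) hfin] with x hx
  refine tendsto_average_of_tendsto_average_sq (fun n => hu1 n x) ?_
  have h3 := ENNReal.tendsto_atTop_zero_of_tsum_ne_top hx.ne
  have h4 : Tendsto (fun m : ℕ => (‖∑ n ∈ Finset.range (m ^ 2), u n x‖ / (m : ℝ) ^ 2) ^ 2) atTop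
      (𝓝 0) := by
    have := (ENNReal.tendsto_toReal ENNReal.zero_ne_top).comp h3
    simp only [ENNReal.toReal_zero] at this
    refine this.congr fun m => ?_
    simp only [Function.comp, hG]
    exact ENNReal.toReal_ofReal (by positivity)
  have h5 := h4.sqrt
  simp only [Real.sqrt_zero] at h5
  refine h5.congr fun m => Real.sqrt_sq (by positivity)

open UnitAddTorus

theorem fourier_sum_zsmul {ι : Type*} (s : Finset ι) (n : ℤ) (a : ι → ℤ) (x : ι → UnitAddCircle) :
    fourier n (∑ j ∈ s, a j • x j) = ∏ j ∈ s, fourier (n * a j) (x j) := by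
  classical
  induction s using Finset.induction_on with
  | empty => simp
  | insert j s hj ih =>
    rw [Finset.sum_insert hj, Finset.prod_insert hj, ← ih]
    simp only [fourier_apply, smul_add, AddCircle.toCircle_add, smul_smul, Circle.coe_mul]

theorem prod_fourier {ι : Type*} (s : Finset ι) (a : ι → ℤ) (x : UnitAddCircle) :
    ∏ i ∈ s, fourier (a i) x = fourier (∑ i ∈ s, a i) x := by
  classical
  induction s using Finset.induction_on with
  | empty => simp
  | insert j s hj ih => rw [Finset.prod_insert hj, Finset.sum_insert hj, fourier_add, ih]

theorem mFourier_toralMap {d : ℕ} (S : Matrix (Fin d) (Fin d) ℤ) (k : Fin d → ℤ) (x : Torus d) :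
    mFourier k (toralMap S x) = mFourier (Matrix.vecMul k S) x := by
  simp only [mFourier, ContinuousMap.coe_mk, toralMap, fourier_sum_zsmul]
  rw [Finset.prod_comm]
  refine Finset.prod_congr rfl fun j _ => ?_
  rw [prod_fourier]
  rfl

theorem mFourier_iterate_toralMap {d : ℕ} (S : Matrix (Fin d) (Fin d) ℤ) (n : ℕ)
    (k : Fin d → ℤ) (x : Torus d) :
    mFourier k ((toralMap S)^[n] x) = mFourier (Matrix.vecMul k (S ^ n)) x := by
  induction n generalizing k with
  | zero => simp
  | succ n ih =>
    rw [Function.iterate_succ_apply', mFourier_toralMap, ih, Matrix.vecMul_vecMul, ← pow_succ']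

theorem integral_mFourier {d : ℕ} {k : Fin d → ℤ} (hk : k ≠ 0) :
    ∫ x : Torus d, mFourier k x = 0 := by
  obtain ⟨i, hi⟩ := Function.ne_iff.1 hk
  have h1 : ∫ x : UnitAddCircle, fourier (k i) x = 0 :=
    integral_eq_zero_of_add_right_eq_neg (fourier_add_half_inv_index hi one_pos)
  simp only [mFourier, ContinuousMap.coe_mk]
  rw [integral_fintype_prod_volume_eq_prod (fun i (x : UnitAddCircle) => fourier (k i) x)]
  exact Finset.prod_eq_zero (Finset.mem_univ i) h1

instance {d : ℕ} : IsProbabilityMeasure (volume : Measure (Torus d)) := by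
  constructor
  rw [volume_pi, Measure.pi_univ]
  simp

theorem integral_norm_sum_mFourier_sq {d : ℕ} {c : ℕ → Fin d → ℤ} (hc : Function.Injective c)
    (N : ℕ) :
    ∫ x : Torus d, ‖∑ n ∈ Finset.range N, mFourier (c n) x‖ ^ 2 = N := by
  have h1 : ∀ x : Torus d, ((‖∑ n ∈ Finset.range N, mFourier (c n) x‖ ^ 2 : ℝ) : ℂ)
      = ∑ n ∈ Finset.range N, ∑ m ∈ Finset.range N, mFourier (c n - c m) x := by
    intro x
    push_cast
    rw [← Complex.mul_conj', map_sum, Finset.sum_mul_sum]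
    refine Finset.sum_congr rfl fun n _ => Finset.sum_congr rfl fun m _ => ?_
    rw [sub_eq_add_neg, mFourier_add, mFourier_neg]
  have hint : ∀ k : Fin d → ℤ, Integrable (fun x : Torus d => mFourier k x) volume := fun k =>
    Integrable.of_bound (mFourier k).continuous.aestronglyMeasurable ‖mFourier k‖
      (Eventually.of_forall fun x => (mFourier k).norm_coe_le_norm x)
  have h2 : ((∫ x : Torus d, ‖∑ n ∈ Finset.range N, mFourier (c n) x‖ ^ 2 : ℝ) : ℂ) = N := by
    rw [← integral_complex_ofReal]
    simp_rw [h1]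
    rw [integral_finsetSum _ fun n _ => integrable_finsetSum _ fun m _ => hint _]
    rw [Finset.sum_congr rfl (g := fun _ => (1 : ℂ))]
    · simp
    intro n hn
    rw [integral_finsetSum _ fun m _ => hint _, Finset.sum_eq_single n]
    · rw [sub_self, mFourier_zero]; simp
    · intro m _ hm
      exact integral_mFourier (sub_ne_zero.2 fun h => hm (hc h).symm)
    · intro h; exact absurd hn h
  exact_mod_cast h2

/-- A hyperbolic matrix has no root of unity among its eigenvalues, so the dual orbit of a
nontrivial character consists of distinct characters. -/
theorem injective_vecMul_pow {d : ℕ} {S : Matrix (Fin d) (Fin d) ℤ} (hS : IsHyperbolic S)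
    {k : Fin d → ℤ} (hk : k ≠ 0) : Function.Injective fun n : ℕ => Matrix.vecMul k (S ^ n) := by
  have key : ∀ n q : ℕ, 0 < q → Matrix.vecMul k (S ^ n) ≠ Matrix.vecMul k (S ^ (q + n)) := by
    intro n q hq heq
    have h1 : Matrix.vecMul (Matrix.vecMul k (1 - S ^ q)) (S ^ n) = 0 := by
      rw [Matrix.vecMul_vecMul, sub_mul, one_mul, ← pow_add, Matrix.vecMul_sub, heq, sub_self]
    have h2 := Matrix.eq_zero_of_vecMul_eq_zero
      (by rw [Matrix.det_pow]; exact pow_ne_zero _ hS.nonsingular) h1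
    have h3 : (1 - S ^ q).det = 0 := Matrix.exists_vecMul_eq_zero_iff.1 ⟨k, hk, h2⟩
    have h4 : (1 - (S.map (Int.cast : ℤ → ℂ)) ^ q).det = 0 := by
      have h5 := (Int.castRingHom ℂ).map_det (1 - S ^ q)
      rw [h3, map_zero, map_sub, map_one, map_pow] at h5
      exact h5.symm
    obtain ⟨v, hv, hv'⟩ := Matrix.exists_mulVec_eq_zero_iff.2 h4
    have h6 : (complexEnd S ^ q) v = (1 : ℂ) • v := by
      rw [Matrix.sub_mulVec, Matrix.one_mulVec, sub_eq_zero] at hv'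
      rw [complexEnd, ← Matrix.toLin'_pow, Matrix.toLin'_apply, ← hv', one_smul]
    have h7 : Module.End.HasEigenvalue (complexEnd S ^ q) 1 :=
      Module.End.hasEigenvalue_of_hasEigenvector ⟨Module.End.mem_eigenspace_iff.2 h6, hv⟩
    have h8 := h7.mem_spectrum
    rw [spectrum.map_pow_of_pos _ hq] at h8
    obtain ⟨μ, hμ, hμq⟩ := h8
    refine hS.norm_ne_one μ (Module.End.HasEigenvalue.of_mem_spectrum hμ) ?_
    have h9 : ‖μ‖ ^ q = 1 := by
      rw [← norm_pow]
      simp only at hμq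
      rw [hμq, norm_one]
    exact (pow_eq_one_iff_of_nonneg (norm_nonneg _) hq.ne').1 h9
  intro n m hnm
  rcases lt_trichotomy n m with h | h | h
  · refine absurd hnm ?_
    obtain ⟨q, rfl⟩ := Nat.exists_eq_add_of_lt h
    have := key n (q + 1) (by omega)
    rwa [show q + 1 + n = n + q + 1 by omega] at this
  · exact h
  · refine absurd hnm.symm ?_
    obtain ⟨q, rfl⟩ := Nat.exists_eq_add_of_lt h
    have := key m (q + 1) (by omega)
    rwa [show q + 1 + m = m + q + 1 by omega] at this

/-- Weyl's criterion. -/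
theorem mem_equi_of_mFourier {d : ℕ} {S : Matrix (Fin d) (Fin d) ℤ} {x : Torus d}
    (h : ∀ k : Fin d → ℤ, k ≠ 0 → Tendsto (fun N : ℕ => (N : ℂ)⁻¹ *
      ∑ n ∈ Finset.range N, mFourier k ((toralMap S)^[n] x)) atTop (𝓝 0)) : x ∈ Equi S := by
  set avg : ℕ → C(Torus d, ℂ) → ℂ := fun N f =>
    (N : ℂ)⁻¹ * ∑ n ∈ Finset.range N, f ((toralMap S)^[n] x) with havg
  have hint : ∀ f : C(Torus d, ℂ), Integrable (fun x : Torus d => f x) volume := fun f =>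
    Integrable.of_bound f.continuous.aestronglyMeasurable ‖f‖
      (Eventually.of_forall fun x => f.norm_coe_le_norm x)
  have hspan : ∀ f ∈ Submodule.span ℂ (Set.range (mFourier (d := Fin d))),
      Tendsto (fun N => avg N f) atTop (𝓝 (∫ y, f y)) := by
    intro f hf
    induction hf using Submodule.span_induction with
    | mem f hf =>
      obtain ⟨k, rfl⟩ := hf
      by_cases hk : k = 0
      · subst hk
        have : ∫ y : Torus d, mFourier (0 : Fin d → ℤ) y = 1 := by
          rw [mFourier_zero]; simp
        rw [this]
        refine tendsto_const_nhds.congr' ?_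
        filter_upwards [eventually_ge_atTop 1] with N hN
        have : (N : ℂ) ≠ 0 := by exact_mod_cast (by omega : N ≠ 0)
        simp [havg, mFourier_zero, this]
      · rw [integral_mFourier hk]; exact h k hk
    | zero => simp [havg]
    | add f g _ _ hf hg =>
      have := hf.add hg
      simp only [ContinuousMap.add_apply]
      rw [integral_add (hint f) (hint g)]
      refine this.congr fun N => ?_
      simp only [havg, ContinuousMap.add_apply, Finset.sum_add_distrib, mul_add]
    | smul a f _ hf =>
      have := hf.const_mul a
      simp only [ContinuousMap.smul_apply, smul_eq_mul]
      rw [integral_const_mul]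
      refine this.congr fun N => ?_
      simp only [havg, ContinuousMap.smul_apply, smul_eq_mul, ← Finset.mul_sum]
      ring
  intro f
  change Tendsto (fun N => avg N f) atTop (𝓝 (∫ y, f y))
  rw [Metric.tendsto_atTop]
  intro ε hε
  have hf : f ∈ closure (Submodule.span ℂ (Set.range (mFourier (d := Fin d))) :
      Set C(Torus d, ℂ)) := by
    rw [← Submodule.topologicalClosure_coe, span_mFourier_closure_eq_top]
    trivial
  obtain ⟨g, hg, hfg⟩ := Metric.mem_closure_iff.1 hf (ε / 3) (by positivity)
  rw [dist_eq_norm] at hfg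
  obtain ⟨N₀, hN₀⟩ := Metric.tendsto_atTop.1 (hspan g hg) (ε / 3) (by positivity)
  refine ⟨N₀, fun N hN => ?_⟩
  have hpt : ∀ y, ‖f y - g y‖ ≤ ‖f - g‖ := fun y => (f - g).norm_coe_le_norm y
  have h1 : dist (avg N f) (avg N g) ≤ ‖f - g‖ := by
    rw [dist_eq_norm]
    simp only [havg]
    rw [← mul_sub, ← Finset.sum_sub_distrib, norm_mul, norm_inv, Complex.norm_natCast]
    rcases Nat.eq_zero_or_pos N with rfl | hN0
    · simp
    have hN0' : (0 : ℝ) < N := by exact_mod_cast hN0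
    rw [inv_mul_le_iff₀ hN0']
    refine (norm_sum_le _ _).trans ((Finset.sum_le_sum fun n _ => hpt _).trans ?_)
    simp
  have h2 : dist (∫ y, g y) (∫ y, f y) ≤ ‖f - g‖ := by
    rw [dist_comm, dist_eq_norm, ← integral_sub (hint f) (hint g)]
    refine (norm_integral_le_of_norm_le_const (Eventually.of_forall hpt)).trans ?_
    simp
  have h3 := hN₀ N hN
  have h4 := dist_triangle4 (avg N f) (avg N g) (∫ y, g y) (∫ y, f y)
  linarith

theorem ae_mem_equi {d : ℕ} {S : Matrix (Fin d) (Fin d) ℤ} (hS : IsHyperbolic S) :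
    ∀ᵐ x : Torus d, x ∈ Equi S := by
  have h1 : ∀ k : Fin d → ℤ, ∀ᵐ x : Torus d, k ≠ 0 → Tendsto (fun N : ℕ => (N : ℂ)⁻¹ *
      ∑ n ∈ Finset.range N, mFourier k ((toralMap S)^[n] x)) atTop (𝓝 0) := by
    intro k
    by_cases hk : k = 0
    · exact Eventually.of_forall fun x h => absurd hk h
    have h2 := ae_tendsto_average_zero (μ := (volume : Measure (Torus d)))
      (u := fun n x => mFourier (Matrix.vecMul k (S ^ n)) x)
      (fun n => (mFourier _).continuous.measurable)
      (fun n x => (ContinuousMap.norm_coe_le_norm _ x).trans mFourier_norm.le)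
      (fun N => (integral_norm_sum_mFourier_sq (injective_vecMul_pow hS hk) N).le)
    filter_upwards [h2] with x hx _
    simpa only [mFourier_iterate_toralMap] using hx
  filter_upwards [ae_all_iff.2 h1] with x hx
  exact mem_equi_of_mFourier hx

/-! ### Orbits of nearby points on the torus -/

theorem iterate_toralMap_proj {d : ℕ} (M : Matrix (Fin d) (Fin d) ℤ) (n : ℕ) (v : Fin d → ℝ) :
    (toralMap M)^[n] (proj v) = proj ((realMat M ^ n).mulVec v) := by
  induction n with
  | zero => simp
  | succ n ih =>
    rw [Function.iterate_succ_apply', ih, toralMap_proj, Matrix.mulVec_mulVec, pow_succ']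
    rfl

theorem norm_coe_unitAddCircle_le (x : ℝ) : ‖(x : UnitAddCircle)‖ ≤ |x| := by
  rw [UnitAddCircle.norm_eq]
  simpa using round_le x 0

theorem dist_proj_le {d : ℕ} (u v : Fin d → ℝ) : dist (proj u) (proj v) ≤ dist u v := by
  refine (dist_pi_le_iff dist_nonneg).2 fun i => ?_
  rw [dist_eq_norm, proj, proj, ← AddCircle.coe_sub]
  refine (norm_coe_unitAddCircle_le _).trans ?_
  rw [← Real.dist_eq]
  exact dist_le_pi_dist u v i

/-- The projection to the torus is isometric at distances up to `1 / 2`. -/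
theorem dist_le_dist_proj {d : ℕ} {u v : Fin d → ℝ} (h : dist u v ≤ 1 / 2) :
    dist u v ≤ dist (proj u) (proj v) := by
  refine (dist_pi_le_iff dist_nonneg).2 fun i => ?_
  refine le_trans (le_of_eq ?_) (dist_le_pi_dist (proj u) (proj v) i)
  rw [dist_eq_norm (proj u i), proj, proj, ← AddCircle.coe_sub, Real.dist_eq]
  refine ((AddCircle.norm_coe_eq_abs_iff (p := (1 : ℝ)) one_ne_zero).2 ?_).symm
  rw [abs_one, ← Real.dist_eq]
  exact (dist_le_pi_dist u v i).trans h

theorem tendsto_dist_iterate {d : ℕ} {M : Matrix (Fin d) (Fin d) ℤ} {w : Fin d → ℝ}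
    (hw : w ∈ contracted M) (v : Fin d → ℝ) :
    Tendsto (fun n : ℕ => dist ((toralMap M)^[n] (proj (v + w))) ((toralMap M)^[n] (proj v)))
      atTop (𝓝 0) := by
  have h1 := (tendsto_mulVec_of_mem_contracted hw).norm
  rw [norm_zero] at h1
  refine squeeze_zero (fun _ => dist_nonneg) (fun n => ?_) h1
  rw [iterate_toralMap_proj, iterate_toralMap_proj]
  refine (dist_proj_le _ _).trans (le_of_eq ?_)
  rw [dist_eq_norm, Matrix.mulVec_add, add_sub_cancel_left]

/-- Equidistribution is not affected by a translation along the contracted subspace. -/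
theorem proj_add_mem_equi {d : ℕ} {M : Matrix (Fin d) (Fin d) ℤ} {v w : Fin d → ℝ}
    (hv : proj v ∈ Equi M) (hw : w ∈ contracted M) : proj (v + w) ∈ Equi M := by
  intro f
  have huc : UniformContinuous f := CompactSpace.uniformContinuous_of_continuous f.continuous
  have h1 : Tendsto (fun n : ℕ => f ((toralMap M)^[n] (proj (v + w)))
      - f ((toralMap M)^[n] (proj v))) atTop (𝓝 0) := by
    rw [Metric.tendsto_atTop]
    intro ε hε
    obtain ⟨δ, hδ, hf⟩ := Metric.uniformContinuous_iff.1 huc ε hε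
    obtain ⟨n₀, hn₀⟩ := Metric.tendsto_atTop.1 (tendsto_dist_iterate hw v) δ hδ
    refine ⟨n₀, fun n hn => ?_⟩
    have h2 := hn₀ n hn
    rw [Real.dist_eq, sub_zero, abs_of_nonneg dist_nonneg] at h2
    rw [dist_zero_right, ← dist_eq_norm]
    exact hf h2
  have h2 := (hv f).add h1.cesaro_smul
  rw [add_zero] at h2
  refine h2.congr fun N => ?_
  rw [Complex.real_smul, Finset.sum_sub_distrib]
  push_cast
  ring

/-- If the orbit of `v` keeps away from the integer points, then no translate of `v` along the
contracted subspace has a dense orbit: up to finitely many points, its orbit avoids a ball. -/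
theorem proj_add_mem_nd {d : ℕ} (hd : 0 < d) {M : Matrix (Fin d) (Fin d) ℤ} {v w : Fin d → ℝ}
    {δ : ℝ} (hδ : 0 < δ)
    (hv : ∀ n : ℕ, ∀ m : Fin d → ℤ, ∃ i, δ ≤ |(realMat M ^ n).mulVec v i - m i|)
    (hw : w ∈ contracted M) : proj (v + w) ∈ ND M := by
  intro hD
  have : Nonempty (Fin d) := ⟨⟨0, hd⟩⟩
  have hdense : Dense (Set.range fun n : ℕ => (toralMap M)^[n] (proj (v + w))) :=
    dense_iff_closure_eq.2 hD
  obtain ⟨n₀, hn₀⟩ := Metric.tendsto_atTop.1 (tendsto_dist_iterate hw v) (δ / 2) (by positivity)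
  have hfin : ((fun n : ℕ => (toralMap M)^[n] (proj (v + w))) '' Set.Iio n₀).Finite :=
    (Set.finite_Iio n₀).image _
  have : Nontrivial UnitAddCircle := by
    refine ⟨((1 / 2 : ℝ) : UnitAddCircle), 0, ?_⟩
    rw [← norm_ne_zero_iff, (AddCircle.norm_coe_eq_abs_iff (p := (1 : ℝ)) one_ne_zero).2] <;>
      norm_num [abs_of_pos]
  obtain ⟨y, hy, hyb⟩ := (hdense.sdiff_finite hfin).exists_dist_lt (0 : Torus d) (half_pos hδ)
  obtain ⟨⟨n, rfl⟩, hn⟩ := hy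
  have hnn : n₀ ≤ n := by
    by_contra h
    exact hn ⟨n, not_le.1 h, rfl⟩
  have h1 := hn₀ n hnn
  rw [Real.dist_eq, sub_zero, abs_of_nonneg dist_nonneg, iterate_toralMap_proj M n v] at h1
  obtain ⟨i, hi⟩ := hv n fun i => round ((realMat M ^ n).mulVec v i)
  have h2 : δ ≤ dist (0 : Torus d) (proj ((realMat M ^ n).mulVec v)) := by
    refine le_trans ?_ (dist_le_pi_dist _ _ i)
    rw [Pi.zero_apply, dist_zero_left, proj, UnitAddCircle.norm_eq]
    exact hi
  have h3 := dist_triangle (0 : Torus d) ((toralMap M)^[n] (proj (v + w)))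
    (proj ((realMat M ^ n).mulVec v))
  linarith

/-- Only the part of the preimage in a fundamental domain is needed. -/
theorem volume_proj_notMem_eq_zero {d : ℕ} {G : Set (Torus d)} (hG : ∀ᵐ x : Torus d, x ∈ G) :
    volume {v : Fin d → ℝ | ‖v‖ ≤ 1 / 4 ∧ proj v ∉ G} = 0 := by
  have hmp : MeasurePreserving (proj (d := d))
      (Measure.pi fun _ => volume.restrict (Set.Ioc (-(1 / 2) : ℝ) (-(1 / 2) + 1))) volume :=
    measurePreserving_pi _ _ fun _ => UnitAddCircle.measurePreserving_mk (-(1 / 2))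
  have h1 := hmp.quasiMeasurePreserving.preimage_null (s := Gᶜ) hG
  rw [← Measure.restrict_pi_pi, Measure.restrict_apply'
    (MeasurableSet.univ_pi fun _ => measurableSet_Ioc)] at h1
  refine measure_mono_null ?_ h1
  rintro v ⟨hv, hvG⟩
  refine ⟨hvG, fun i _ => ?_⟩
  have := abs_le.1 ((norm_le_pi_norm v i).trans hv)
  constructor <;> linarith [this.1, this.2]

/-! ### Hausdorff dimension -/

/-- The mass distribution principle for the product of a measure of dimension `s` and Lebesgue
measure. -/
theorem add_le_dimH_prod {k l : ℕ} {ν : Measure (Fin k → ℝ)} [SFinite ν] {s : ℝ} (hs : 0 ≤ s)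
    {D : ENNReal} (hD : D ≠ ⊤) (hν : ∀ E, ν E ≤ D * Metric.ediam E ^ s)
    {A : Set (Fin k → ℝ)} {B : Set (Fin l → ℝ)} (hA : ν A ≠ 0) (hB : volume B ≠ 0) :
    ENNReal.ofReal (s + l) ≤ dimH (A ×ˢ B) := by
  -- `D` itself may vanish, and the measure is to be divided by the constant
  have hD0 : D + 1 ≠ 0 := by simp
  have hDt : D + 1 ≠ ⊤ := by simp [hD]
  have hle : (D + 1)⁻¹ • ν.prod volume
      ≤ Measure.hausdorffMeasure (X := (Fin k → ℝ) × (Fin l → ℝ)) (s + l) := by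
    refine Measure.le_hausdorffMeasure _ _ 1 one_pos fun E _ => ?_
    have h1 : ν.prod volume E ≤ (D + 1) * Metric.ediam E ^ (s + l) := by
      calc ν.prod volume E ≤ ν.prod volume ((Prod.fst '' E) ×ˢ (Prod.snd '' E)) :=
            measure_mono Set.subset_fst_image_prod_snd_image
        _ = ν (Prod.fst '' E) * volume (Prod.snd '' E) := Measure.prod_prod _ _
        _ ≤ (D * Metric.ediam E ^ s) * Metric.ediam E ^ (l : ℝ) := by
            gcongr
            · refine (hν _).trans ?_
              gcongr
              simpa using LipschitzWith.prod_fst.ediam_image_le E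
            · refine (Real.volume_pi_le_diam_pow _).trans ?_
              rw [Fintype.card_fin, ENNReal.rpow_natCast]
              gcongr
              simpa using LipschitzWith.prod_snd.ediam_image_le E
        _ = D * Metric.ediam E ^ (s + l) := by
            rw [mul_assoc, ENNReal.rpow_add_of_nonneg _ _ hs (Nat.cast_nonneg l)]
        _ ≤ _ := by gcongr; exact le_self_add
    rw [Measure.smul_apply, smul_eq_mul]
    calc (D + 1)⁻¹ * ν.prod volume E
        ≤ (D + 1)⁻¹ * ((D + 1) * Metric.ediam E ^ (s + l)) := by gcongr
      _ = _ := by rw [← mul_assoc, ENNReal.inv_mul_cancel hD0 hDt, one_mul]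
  refine le_dimH_of_hausdorffMeasure_ne_zero (d := (s + l).toNNReal) ?_
  rw [Real.coe_toNNReal _ (by positivity)]
  refine (lt_of_lt_of_le ?_ (hle _)).ne'
  rw [Measure.smul_apply, Measure.prod_prod, smul_eq_mul]
  have := ENNReal.inv_ne_zero.2 hDt
  exact pos_iff_ne_zero.2 (mul_ne_zero this (mul_ne_zero hA hB))

theorem dimH_torus_le {d : ℕ} (s : Set (Torus d)) : dimH s ≤ d := by
  have h1 : Function.Surjective (proj (d := d)) := fun x => by
    choose v hv using fun i => QuotientAddGroup.mk_surjective (x i)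
    exact ⟨v, funext hv⟩
  have h2 : LipschitzWith 1 (proj (d := d)) := LipschitzWith.of_dist_le_mul fun u v => by
    simpa using dist_proj_le u v
  calc dimH s ≤ dimH (Set.range (proj (d := d))) := dimH_mono (by rw [h1.range_eq]; simp)
    _ ≤ dimH (Set.univ : Set (Fin d → ℝ)) := h2.dimH_range_le
    _ = d := Real.dimH_univ_pi_fin d

/-- The set contains a bi-Lipschitz copy of a product `A ×ˢ B`: the coordinate along a subspace
`V` contracted by `S` decides about the orbit under `T`, the coordinate along the subspace
contracted by `T` decides about the orbit under `S`. -/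
theorem add_le_dimH_equi_inter_nd {d : ℕ} {S T : Matrix (Fin d) (Fin d) ℤ} (hd : 0 < d)
    (hS : IsHyperbolic S) (hT : IsHyperbolic T) {V : Submodule ℝ (Fin d → ℝ)}
    (hVS : V ≤ contracted S) (hVT : IsCompl V (contracted T)) {s : ℝ} (hs0 : 0 < s)
    (hs : s < Module.finrank ℝ V) :
    ENNReal.ofReal (s + Module.finrank ℝ (contracted T)) ≤ dimH (Equi S ∩ ND T) := by
  set k := Module.finrank ℝ V with hk
  set l := Module.finrank ℝ (contracted T) with hl
  have hk0 : 0 < k := by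
    have : (0 : ℝ) < k := hs0.trans hs
    exact_mod_cast this
  set bV := Module.finBasis ℝ V with hbV
  set bW := Module.finBasis ℝ (contracted T) with hbW
  set Φ : ((Fin k → ℝ) × (Fin l → ℝ)) ≃L[ℝ] (Fin d → ℝ) := LinearEquiv.toContinuousLinearEquiv
    ((bV.equivFun.symm.prodCongr bW.equivFun.symm).trans
      (Submodule.prodEquivOfIsCompl V (contracted T) hVT)) with hΦ
  have hΦ' : ∀ x y, Φ (x, y) = (bV.equivFun.symm x : Fin d → ℝ) + bW.equivFun.symm y :=
    fun x y => by
      change Submodule.prodEquivOfIsCompl V (contracted T) hVT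
        (bV.equivFun.symm x, bW.equivFun.symm y) = _
      rw [Submodule.coe_prodEquivOfIsCompl']
  set A : ℕ → Fin d → Fin k → ℝ := fun n i j => (realMat T ^ n).mulVec (bV j) i with hA
  have hAlin : ∀ n x, linMap (A n) x = (realMat T ^ n).mulVec (bV.equivFun.symm x) := by
    intro n x
    funext i
    rw [Module.Basis.equivFun_symm_apply]
    simp only [linMap, hA]
    rw [Submodule.coe_sum, Matrix.mulVec_sum, Finset.sum_apply]
    refine Finset.sum_congr rfl fun j _ => ?_
    rw [Submodule.coe_smul, Matrix.mulVec_smul, Pi.smul_apply, smul_eq_mul, mul_comm]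
  have hAcol : ∀ n j, ‖(realMat T ^ n).mulVec (bV j : Fin d → ℝ)‖ ≤ ‖A n‖ := fun n j =>
    (pi_norm_le_iff_of_nonneg (norm_nonneg _)).2 fun i => abs_coeff_le (A n) i j
  obtain ⟨C, hC, θ, hθ0, hθ1, hgrow⟩ := exists_norm_mulVec_le_of_disjoint hT hVT.disjoint
  have hA0 : 0 < ‖A 0‖ := by
    refine lt_of_lt_of_le ?_ (hAcol 0 ⟨0, hk0⟩)
    rw [pow_zero, Matrix.one_mulVec, norm_pos_iff]
    exact fun h => bV.ne_zero ⟨0, hk0⟩ (Subtype.ext h)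
  have hAg : ∀ n m, ‖A n‖ ≤ C * θ ^ m * ‖A (n + m)‖ := by
    intro n m
    have h0 : 0 ≤ C * θ ^ m * ‖A (n + m)‖ := by positivity
    refine (pi_norm_le_iff_of_nonneg h0).2 fun i => (pi_norm_le_iff_of_nonneg h0).2 fun j => ?_
    refine (norm_le_pi_norm ((realMat T ^ n).mulVec (bV j : Fin d → ℝ)) i).trans ?_
    refine (hgrow n m _ (bV j).2).trans ?_
    gcongr
    exact hAcol _ _
  set R : ℝ := 1 / (4 * (‖(Φ : ((Fin k → ℝ) × (Fin l → ℝ)) →L[ℝ] (Fin d → ℝ))‖ + 1)) with hR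
  have hR0 : 0 < R := by positivity
  have hsmall : ∀ p, ‖p‖ ≤ R → ‖Φ p‖ ≤ 1 / 4 := by
    intro p hp
    refine ((Φ : ((Fin k → ℝ) × (Fin l → ℝ)) →L[ℝ] (Fin d → ℝ)).le_opNorm p).trans ?_
    calc _ ≤ (‖(Φ : ((Fin k → ℝ) × (Fin l → ℝ)) →L[ℝ] (Fin d → ℝ))‖ + 1) * R := by
          gcongr
          linarith
      _ = 1 / 4 := by rw [hR]; field_simp
  obtain ⟨δ, hδ, ν, hν, hνA, D, hD, hνD⟩ :=
    exists_measure_avoiding hk0 A hC hθ0 hθ1 hA0 hAg hs0 hs hR0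
  set X : Set (Fin k → ℝ) := {x | (∀ i, |x i| ≤ R) ∧
    ∀ n, ∀ m : Fin d → ℤ, ∃ i, δ ≤ |linMap (A n) x i - m i|} with hX
  set Y : Set (Fin l → ℝ) := {y | ‖y‖ ≤ R ∧ proj (Φ (0, y)) ∈ Equi S} with hY
  have hsplit : ∀ x y, Φ (x, y) = Φ (0, y) + (bV.equivFun.symm x : Fin d → ℝ) := by
    intro x y
    rw [hΦ', hΦ', map_zero, Submodule.coe_zero, zero_add, add_comm]
  have hYbad : volume {y : Fin l → ℝ | ‖y‖ ≤ R ∧ proj (Φ (0, y)) ∉ Equi S} = 0 := by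
    have h1 := volume_proj_notMem_eq_zero (ae_mem_equi hS)
    have h2 : volume (Φ ⁻¹' {v : Fin d → ℝ | ‖v‖ ≤ 1 / 4 ∧ proj v ∉ Equi S}) = 0 := by
      have h3 : (Measure.map Φ volume) {v : Fin d → ℝ | ‖v‖ ≤ 1 / 4 ∧ proj v ∉ Equi S} = 0 := by
        have : (volume : Measure ((Fin k → ℝ) × (Fin l → ℝ))).IsAddHaarMeasure :=
          Measure.prod.instIsAddHaarMeasure _ _
        have : (Measure.map Φ volume).IsAddHaarMeasure := Φ.isAddHaarMeasure_map volume
        rw [Measure.isAddLeftInvariant_eq_smul (Measure.map Φ volume) volume, Measure.smul_apply, h1,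
          smul_zero]
      exact le_antisymm ((Measure.le_map_apply Φ.continuous.measurable.aemeasurable _).trans h3.le)
        bot_le
    have h3 : volume (Metric.closedBall (0 : Fin k → ℝ) R ×ˢ
        {y : Fin l → ℝ | ‖y‖ ≤ R ∧ proj (Φ (0, y)) ∉ Equi S}) = 0 := by
      refine measure_mono_null ?_ h2
      rintro ⟨x, y⟩ ⟨hx, hy, hyE⟩
      refine ⟨hsmall _ (max_le (mem_closedBall_zero_iff.1 hx) hy), fun h => hyE ?_⟩
      have h4 := proj_add_mem_equi h
        (neg_mem (hVS (bV.equivFun.symm x).2))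
      rwa [hsplit, add_neg_cancel_right] at h4
    rw [Measure.volume_eq_prod, Measure.prod_prod, mul_eq_zero] at h3
    exact h3.resolve_left (Metric.measure_closedBall_pos volume _ hR0).ne'
  have hY0 : volume Y ≠ 0 := by
    intro h
    refine (Metric.measure_closedBall_pos volume (0 : Fin l → ℝ) hR0).ne' ?_
    refine measure_mono_null (fun y hy => ?_) (measure_union_null h hYbad)
    have hy' := mem_closedBall_zero_iff.1 hy
    by_cases hyE : proj (Φ (0, y)) ∈ Equi S
    · exact Or.inl ⟨hy', hyE⟩
    · exact Or.inr ⟨hy', hyE⟩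
  have hdim : ENNReal.ofReal (s + l) ≤ dimH (X ×ˢ Y) :=
    add_le_dimH_prod hs0.le hD hνD (by rw [hνA]; exact one_ne_zero) hY0
  set g : (X ×ˢ Y : Set ((Fin k → ℝ) × (Fin l → ℝ))) → Torus d := fun p => proj (Φ p) with hg
  have hnorm : ∀ p ∈ X ×ˢ Y, ‖Φ p‖ ≤ 1 / 4 := fun p hp =>
    hsmall p (max_le ((pi_norm_le_iff_of_nonneg hR0.le).2 hp.1.1) hp.2.1)
  have hganti : AntilipschitzWith ‖(Φ.symm : (Fin d → ℝ) →L[ℝ] ((Fin k → ℝ) × (Fin l → ℝ)))‖₊ g :=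
    AntilipschitzWith.of_le_mul_dist fun p q => by
      refine (Φ.antilipschitz.le_mul_dist (p : (Fin k → ℝ) × (Fin l → ℝ)) q).trans ?_
      gcongr
      refine dist_le_dist_proj ?_
      rw [dist_eq_norm]
      have h1 := hnorm p p.2
      have h2 := hnorm q q.2
      have h3 := norm_sub_le (Φ p) (Φ q)
      linarith
  have hgrange : g '' Set.univ ⊆ Equi S ∩ ND T := by
    rintro _ ⟨⟨⟨x, y⟩, hx, hy⟩, -, rfl⟩
    constructor
    · change proj (Φ (x, y)) ∈ Equi S
      rw [hsplit]
      exact proj_add_mem_equi hy.2 (hVS (bV.equivFun.symm x).2)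
    · change proj (Φ (x, y)) ∈ ND T
      rw [hΦ']
      refine proj_add_mem_nd hd hδ (fun n m => ?_) (bW.equivFun.symm y).2
      rw [← hAlin]
      exact hx.2 n m
  calc ENNReal.ofReal (s + l) ≤ dimH (X ×ˢ Y) := hdim
    _ = dimH (Set.univ : Set (X ×ˢ Y : Set ((Fin k → ℝ) × (Fin l → ℝ)))) := by
        have h1 : Isometry (Subtype.val : (X ×ˢ Y : Set ((Fin k → ℝ) × (Fin l → ℝ))) → _) :=
          isometry_subtype_coe
        rw [← h1.dimH_image, Set.image_univ, Subtype.range_coe]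
    _ ≤ dimH (g '' Set.univ) := hganti.le_dimH_image _
    _ ≤ dimH (Equi S ∩ ND T) := dimH_mono hgrange

end ToralEndo

end

theorem theorem3p1 (d : ℕ) (S T : Matrix (Fin d) (Fin d) ℤ)
    (hS : ToralEndo.IsHyperbolic S) (hT : ToralEndo.IsHyperbolic T)
    (hs : ToralEndo.contracted S ≠ ⊥) (ht : ToralEndo.contracted T ≠ ⊥)
    (hspan : ToralEndo.contracted S ⊔ ToralEndo.contracted T = ⊤) :
    dimH (ToralEndo.Equi S ∩ ToralEndo.ND T) = (d : ENNReal) := by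
  have hd : 0 < d := by
    rcases Nat.eq_zero_or_pos d with rfl | hd
    · exact absurd (Subsingleton.elim _ _) hs
    · exact hd
  refine le_antisymm (ToralEndo.dimH_torus_le _) ?_
  -- a complement of the subspace contracted by `T` inside the subspace contracted by `S`
  obtain ⟨U, hU⟩ := exists_isCompl (ToralEndo.contracted S ⊓ ToralEndo.contracted T)
  set V := U ⊓ ToralEndo.contracted S with hV
  have hVT : IsCompl V (ToralEndo.contracted T) := by
    refine ⟨disjoint_iff.2 ?_, codisjoint_iff.2 ?_⟩
    · rw [hV, inf_assoc, inf_comm]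
      exact hU.inf_eq_bot
    · have h1 : ToralEndo.contracted S ≤ V ⊔ ToralEndo.contracted T := by
        calc ToralEndo.contracted S
            = (ToralEndo.contracted S ⊓ ToralEndo.contracted T ⊔ U)
                ⊓ ToralEndo.contracted S := by rw [hU.sup_eq_top, top_inf_eq]
          _ = ToralEndo.contracted S ⊓ ToralEndo.contracted T ⊔ V :=
              sup_inf_assoc_of_le _ inf_le_left
          _ ≤ _ := sup_le (inf_le_right.trans le_sup_right) le_sup_left
      rw [eq_top_iff, ← hspan]
      exact sup_le h1 le_sup_right
  have hdim := Submodule.finrank_add_eq_of_isCompl hVT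
  rw [Module.finrank_fin_fun] at hdim
  have hdim' : (Module.finrank ℝ V : ℝ) + Module.finrank ℝ (ToralEndo.contracted T) = d := by
    exact_mod_cast hdim
  have hk : 0 < Module.finrank ℝ V := by
    rw [Module.finrank_pos_iff_exists_ne_zero]
    by_contra! h
    refine ToralEndo.contracted_ne_top hd hT ?_
    have hVbot : V = ⊥ := (Submodule.eq_bot_iff _).2 fun v hv => congrArg Subtype.val (h ⟨v, hv⟩)
    rw [← hVT.sup_eq_top, hVbot, bot_sup_eq]
  have hk0 : (0 : ℝ) < Module.finrank ℝ V := by exact_mod_cast hk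
  refine le_of_forall_lt fun c hc => ?_
  obtain ⟨a, rfl⟩ : ∃ a : NNReal, (a : ENNReal) = c :=
    ⟨c.toNNReal, ENNReal.coe_toNNReal hc.ne_top⟩
  have ha : (a : ℝ) < d := by exact_mod_cast hc
  set k : ℝ := ((Module.finrank ℝ V : ℕ) : ℝ) with hkdef
  set l : ℝ := ((Module.finrank ℝ (ToralEndo.contracted T) : ℕ) : ℝ) with hldef
  -- an exponent below `k` with `s + l` still above `a`
  set s : ℝ := max (k / 2) ((a - l + k) / 2) with hsdef
  have hs0 : 0 < s := lt_max_of_lt_left (by positivity)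
  have hsk : s < k := max_lt (by linarith) (by linarith)
  have hsa : (a : ℝ) < s + l := by
    have : (a - l + k) / 2 ≤ s := le_max_right _ _
    linarith
  refine lt_of_lt_of_le ?_
    (ToralEndo.add_le_dimH_equi_inter_nd hd hS hT inf_le_right hVT hs0 hsk)
  rw [← ENNReal.ofReal_coe_nnreal]
  exact (ENNReal.ofReal_lt_ofReal_iff (lt_of_le_of_lt a.2 hsa)).2 hsa
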